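/- Let $\theta>0$ and let $a,b>-1$ be real with $a+b>-1$; let $N\ge 0$ be an integer. For $z\in\mathbb R^N$ write $\Delta(z)=\prod_{1\le j<k\le N}(z_k-z_j)$ and $z^\theta=(z_1^\theta,\dots,z_N^\theta)$. The $\theta$-deformed Cauchy–Laguerre two-matrix model consists of $N$ particles $x_1,\dots,x_N>0$ of one kind and $N$ particles $y_1,\dots,y_N>0$ of a second kind, with unnormalised density $$p(x,y)=\prod_{j=1}^N x_j^ae^{-x_j}y_j^be^{-y_j}\;\frac{\Delta(x)\Delta(y)}{\prod_{j,k=1}^N(x_j+y_k)}\;\Delta(x^\theta)\Delta(y^\theta)\quad\text{on }\mathbb R_+^N\times\mathbb R_+^N ,$$ and partition function $Z_N=\frac1{(N!)^2}\int_{\mathbb R_+^N\times\mathbb R_+^N}p(x,y)\,dx\,dy$. For $0\le r,s\le N$ its $(r,s)$-correlation function is $$\rho_{r,s}(x_1,\dots,x_r;y_1,\dots,y_s)=\frac{\prod_{j=1}^r x_j^ae^{-x_j}\prod_{j=1}^s y_j^be^{-y_j}}{(N-r)!\,(N-s)!\,Z_N}\int_{\mathbb R_+^{N-r}\times\mathbb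 R_+^{N-s}}\Delta(x^\theta)\Delta(y^\theta)\det\Big[\frac1{x_i+y_j}\Big]_{i,j=1}^N\prod_{j=r+1}^N x_j^ae^{-x_j}dx_j\prod_{j=s+1}^N y_j^be^{-y_j}dy_j .$$ Let $h_n=\frac{\theta}{2n\theta+a+b+1}$. A pair of families of real polynomials $(\hat P_n)_{n\ge0}$, $(\hat Q_n)_{n\ge0}$ with $\deg\hat P_n=\deg\hat Q_n=n$ is called $\theta$-deformed Cauchy bi-orthogonal if $$\iint_{\mathbb R_+^2}\frac{e^{-(x+y)}}{x+y}x^ay^b\hat P_n(x^\theta)\hat Q_m(y^\theta)\,dx\,dy=\frac{h_n}{\theta}\delta_{n,m}\qquad(n,m\ge0).$$ For such a pair define the Christoffel–Darboux kernel $K_{00}(x,y)=K_N(x,y)=\sum_{n=0}^{N-1}\frac{\theta}{h_n}\hat P_n(x^\theta)\hat Q_n(y^\theta)$ and its Cauchy transforms $$K_{01}(x,x')=\int_{\mathbb R_+}\frac{K_N(x,y)}{x'+y}y^be^{-y}dy,\qquad K_{10}(y,y')=\int_{\mathbb R_+}\frac{K_N(x,y')}{x+y}x^ae^{-x}dx,$$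 $$K_{11}(y,x)=\int_{\mathbb R_+^2}\frac{K_N(x',y')}{(x'+y)(x+y')}x'^ay'^be^{-(x'+y')}dx'dy'-\frac1{x+y}.$$ Then the following hold. 1. $p\ge0$, and $p/((N!)^2Z_N)$ is a probability density on $\mathbb R_+^N\times\mathbb R_+^N$. 2. With $\alpha=\frac{a+b+1}{\theta}-1$ and $c_{n,l}=\frac{(-1)^l\,\Gamma(\alpha+n+l+1)}{l!\,(n-l)!\,\Gamma(\alpha+l+1)}$, the polynomials $\hat P_n(x)=\sum_{l=0}^n\frac{c_{n,l}\,x^l}{\Gamma(a+\theta l+1)}$ and $\hat Q_n(y)=\sum_{l=0}^n\frac{c_{n,l}\,y^l}{\Gamma(b+\theta l+1)}$ are $\theta$-deformed Cauchy bi-orthogonal. 3. For every $\theta$-deformed Cauchy bi-orthogonal pair, the integrals defining $K_{01},K_{10},K_{11}$ converge absolutely for positive arguments, and for all $0\le r,s\le N$: the integral defining $\rho_{r,s}$ converges absolutely at all positive arguments; $\rho_{r,s}$ is the $(r,s)$-correlation function of the point process, i.e. for every measurable $f:\mathbb R^r\times\mathbb R^s\to[0,\infty]$, with expectation over the law of the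 model, $$\mathbb E\sum_{\substack{i_1,\dots,i_r\ \text{distinct}\\ j_1,\dots,j_s\ \text{distinct}}}f(x_{i_1},\dots,x_{i_r};y_{j_1},\dots,y_{j_s})=\int_{\mathbb R_+^r\times\mathbb R_+^s}f\,\rho_{r,s}\,dx\,dy ;$$ and, for all $x_1,\dots,x_r,y_1,\dots,y_s>0$, $$\rho_{r,s}(x_1,\dots,x_r;y_1,\dots,y_s)=\prod_{i=1}^r x_i^ae^{-x_i}\prod_{j=1}^s y_j^be^{-y_j}\;\det\begin{bmatrix}[K_{01}(x_i,x_j)]_{i,j=1}^r&[K_{00}(x_i,y_j)]_{1\le i\le r}^{1\le j\le s}\\ [K_{11}(y_i,x_j)]_{1\le i\le s}^{1\le j\le r}&[K_{10}(y_i,y_j)]_{i,j=1}^s\end{bmatrix}.$$ Thus the model is a two-component determinantal point process. -/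

import Mathlib

open MeasureTheory

noncomputable section

namespace CauchyLaguerre

/-- The open positive orthant of `ℝⁿ`. -/
def posOrthant (n : ℕ) : Set (Fin n → ℝ) := {x | ∀ i, 0 < x i}

/-- The Laguerre weight `x ^ c * e ^ (-x)`. -/
def weight (c x : ℝ) : ℝ := x ^ c * Real.exp (-x)

/-- The product of differences `∏_{j < k} (z_k - z_j)`. -/
def prodDiff {N : ℕ} (z : Fin N → ℝ) : ℝ := ∏ j, ∏ k ∈ Finset.Ioi j, (z k - z j)

/-- The unnormalised eigenvalue density of the θ-deformed Cauchy–Laguerre two-matrix model. -/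
def density {N : ℕ} (a b θ : ℝ) (x y : Fin N → ℝ) : ℝ :=
  (∏ j, weight a (x j) * weight b (y j)) *
    (prodDiff x * prodDiff y / ∏ j, ∏ k, (x j + y k)) *
    (prodDiff (fun j => x j ^ θ) * prodDiff (fun j => y j ^ θ))

/-- The partition function `Z_N(a, b; θ)`. -/
def partitionFunction (N : ℕ) (a b θ : ℝ) : ℝ :=
  (1 / (N.factorial : ℝ)) ^ 2 *
    ∫ z in posOrthant N ×ˢ posOrthant N, density a b θ z.1 z.2

/-- The law of the labelled particles `(x, y) ∈ ℝ₊^N × ℝ₊^N`: the normalised density is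
`density / ((N!)² Z_N)`. -/
def law (N : ℕ) (a b θ : ℝ) : Measure ((Fin N → ℝ) × (Fin N → ℝ)) :=
  (volume.restrict (posOrthant N ×ˢ posOrthant N)).withDensity fun z =>
    ENNReal.ofReal
      (density a b θ z.1 z.2 / ((N.factorial : ℝ) ^ 2 * partitionFunction N a b θ))

/-- The `N`-tuple `(x_1, …, x_r, x_{r+1}, …, x_N)` from its first `r` and last `N - r` entries. -/
def joinVars {r N : ℕ} (hr : r ≤ N) (x : Fin r → ℝ) (x' : Fin (N - r) → ℝ) : Fin N → ℝ :=
  fun i => Fin.append x x' (Fin.cast (Nat.add_sub_cancel' hr).symm i)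

/-- The integrand, in the variables `x_{r+1}, …, x_N, y_{s+1}, …, y_N`, of the
`(r, s)`-correlation function. -/
def correlationIntegrand {N r s : ℕ} (a b θ : ℝ) (hr : r ≤ N) (hs : s ≤ N)
    (x : Fin r → ℝ) (y : Fin s → ℝ) (z : (Fin (N - r) → ℝ) × (Fin (N - s) → ℝ)) : ℝ :=
  (∏ j, weight a (z.1 j)) * (∏ j, weight b (z.2 j)) *
    (prodDiff (fun i => joinVars hr x z.1 i ^ θ) * prodDiff (fun j => joinVars hs y z.2 j ^ θ) *
      (Matrix.of fun i j : Fin N => 1 / (joinVars hr x z.1 i + joinVars hs y z.2 j)).det)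

/-- The `(r, s)`-correlation function `ρ_{r,s}(x_1, …, x_r; y_1, …, y_s)`. -/
def correlation {N r s : ℕ} (a b θ : ℝ) (hr : r ≤ N) (hs : s ≤ N)
    (x : Fin r → ℝ) (y : Fin s → ℝ) : ℝ :=
  (∏ j, weight a (x j)) * (∏ j, weight b (y j)) /
      (((N - r).factorial : ℝ) * ((N - s).factorial : ℝ) * partitionFunction N a b θ) *
    ∫ z in posOrthant (N - r) ×ˢ posOrthant (N - s), correlationIntegrand a b θ hr hs x y z

/-- `ρ` is an `(r, s)`-correlation function of the two-component point process on `ℝ₊` given by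
the law `μ` of `N` particles of each kind: the density of its `(r, s)` factorial moment measure. -/
def IsCorrelationFunction {N : ℕ} (μ : Measure ((Fin N → ℝ) × (Fin N → ℝ))) (r s : ℕ)
    (ρ : (Fin r → ℝ) → (Fin s → ℝ) → ℝ) : Prop :=
  ∀ f : (Fin r → ℝ) × (Fin s → ℝ) → ENNReal, Measurable f →
    ∫⁻ z, ∑ σ : Fin r ↪ Fin N, ∑ τ : Fin s ↪ Fin N, f (z.1 ∘ σ, z.2 ∘ τ) ∂μ =
      ∫⁻ w in posOrthant r ×ˢ posOrthant s, f w * ENNReal.ofReal (ρ w.1 w.2)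

/-- The normalisation `h_n = θ / (2 n θ + a + b + 1)`. -/
def hNorm (a b θ : ℝ) (n : ℕ) : ℝ := θ / (2 * n * θ + a + b + 1)

/-- `P`, `Q` are families of θ-deformed Cauchy bi-orthogonal polynomials with Laguerre weight. -/
def IsCauchyBiorthogonal (a b θ : ℝ) (P Q : ℕ → Polynomial ℝ) : Prop :=
  (∀ n, (P n).natDegree = n ∧ (Q n).natDegree = n) ∧
    ∀ n m, ∫ z in Set.Ioi (0 : ℝ) ×ˢ Set.Ioi (0 : ℝ),
        Real.exp (-(z.1 + z.2)) / (z.1 + z.2) * z.1 ^ a * z.2 ^ b *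
          (P n).eval (z.1 ^ θ) * (Q m).eval (z.2 ^ θ) =
      if n = m then hNorm a b θ n / θ else 0

/-- The parameter `α = (a + b + 1) / θ - 1`. -/
def alphaParam (a b θ : ℝ) : ℝ := (a + b + 1) / θ - 1

/-- The Jacobi coefficients `c_{n,l}`. -/
def jacobiCoeff (α : ℝ) (n l : ℕ) : ℝ :=
  Real.Gamma (α + n + l + 1) /
    ((l.factorial : ℝ) * ((n - l).factorial : ℝ) * Real.Gamma (α + l + 1)) * (-1) ^ l

/-- The explicit polynomial `P̂_n`. -/
def PHat (a b θ : ℝ) (n : ℕ) : Polynomial ℝ :=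
  ∑ l ∈ Finset.range (n + 1), Polynomial.monomial l
    (jacobiCoeff (alphaParam a b θ) n l / Real.Gamma (a + θ * l + 1))

/-- The explicit polynomial `Q̂_n`. -/
def QHat (a b θ : ℝ) (n : ℕ) : Polynomial ℝ :=
  ∑ l ∈ Finset.range (n + 1), Polynomial.monomial l
    (jacobiCoeff (alphaParam a b θ) n l / Real.Gamma (b + θ * l + 1))

section Kernels

variable (a b θ : ℝ) (P Q : ℕ → Polynomial ℝ) (N : ℕ)

/-- The Christoffel–Darboux kernel `K_N = K_{00}`. -/
def K00 (x y : ℝ) : ℝ :=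
  ∑ n ∈ Finset.range N, θ / hNorm a b θ n * (P n).eval (x ^ θ) * (Q n).eval (y ^ θ)

/-- The integrand of `K_{01}(x, x')`. -/
def K01Integrand (x x' y : ℝ) : ℝ := K00 a b θ P Q N x y / (x' + y) * weight b y

/-- The integrand of `K_{10}(y, y')`. -/
def K10Integrand (y y' x : ℝ) : ℝ := K00 a b θ P Q N x y' / (x + y) * weight a x

/-- The integrand of `K_{11}(y, x)`; the integration variable is `z = (x', y')`. -/
def K11Integrand (y x : ℝ) (z : ℝ × ℝ) : ℝ :=
  K00 a b θ P Q N z.1 z.2 / ((z.1 + y) * (x + z.2)) * (weight a z.1 * weight b z.2)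

def K01 (x x' : ℝ) : ℝ := ∫ y in Set.Ioi (0 : ℝ), K01Integrand a b θ P Q N x x' y

def K10 (y y' : ℝ) : ℝ := ∫ x in Set.Ioi (0 : ℝ), K10Integrand a b θ P Q N y y' x

def K11 (y x : ℝ) : ℝ :=
  (∫ z in Set.Ioi (0 : ℝ) ×ˢ Set.Ioi (0 : ℝ), K11Integrand a b θ P Q N y x z) - 1 / (x + y)

/-- The `(r + s) × (r + s)` block matrix of kernels. -/
def kernelMatrix {r s : ℕ} (x : Fin r → ℝ) (y : Fin s → ℝ) :
    Matrix (Fin r ⊕ Fin s) (Fin r ⊕ Fin s) ℝ :=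
  Matrix.fromBlocks
    (Matrix.of fun i j => K01 a b θ P Q N (x i) (x j))
    (Matrix.of fun i j => K00 a b θ P Q N (x i) (y j))
    (Matrix.of fun i j => K11 a b θ P Q N (y i) (x j))
    (Matrix.of fun i j => K10 a b θ P Q N (y i) (y j))

/-- The integrals defining `K_{01}`, `K_{10}`, `K_{11}` converge absolutely on `ℝ₊`. -/
def KernelsConverge : Prop :=
  ∀ u v : ℝ, 0 < u → 0 < v →
    IntegrableOn (K01Integrand a b θ P Q N u v) (Set.Ioi 0) ∧
    IntegrableOn (K10Integrand a b θ P Q N u v) (Set.Ioi 0) ∧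
    IntegrableOn (K11Integrand a b θ P Q N u v) (Set.Ioi (0 : ℝ) ×ˢ Set.Ioi (0 : ℝ))

end Kernels

end CauchyLaguerre

end

/-!
The whole argument rests on the determinant of the block matrix of kernels, built from any pair of
families that is bi-orthonormal with respect to a two-variable pairing. Adding one variable borders
this matrix by a row and a column, and bi-orthonormality evaluates the integral of the bordered
determinant over the new variable, so that variables can be integrated out one at a time. For `N`
variables of each kind the matrix is a product of two `2 × 2` block triangular matrices, so its
determinant is `det[p_n(x_i)] det[q_n(y_i)] det[C(x_i, y_j)]`; by the Vandermonde and Cauchy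
determinant formulas this is a constant multiple of the density. Its integral `(N!)²` fixes the
constant, and all the correlation functions follow.

All integrals converge because the Cauchy kernel satisfies `1 / (x + y) ≤ x ^ (-s) * y ^ (s - 1)`
for `s ∈ [0, 1]`, and `a, b, a + b > -1` leaves room for an `s` which keeps both sides integrable.

For the explicit polynomials, `∬ x ^ A y ^ B e^{-(x+y)} / (x + y) = Γ(A+1) Γ(B+1) / (A+B+1)` cancels
the Gamma factors in the coefficients. What remains is the orthogonality of the Jacobi coefficients,
`∑ l, c_{n,l} / (α + 1 + l + s)`, a partial fraction expansion whose numerator vanishes at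
`s = 0, …, n - 1`.
-/

noncomputable section

namespace CauchyLaguerre

/-! ### Determinants -/

section Determinants

open Matrix Polynomial

theorem det_mul_det_fromBlocks_bordered {n R : Type*} [Fintype n] [DecidableEq n] [CommRing R]
    (A : Matrix n n R) (c r : n → R) (d : R) :
    A.det * (fromBlocks A (replicateCol Unit c) (replicateRow Unit r) (of fun _ _ => d)).det =
      A.det * (d * A.det - r ⬝ᵥ (A.adjugate *ᵥ c)) := by
  have hAadj : A *ᵥ (A.adjugate *ᵥ c) = A.det • c := by
    rw [mulVec_mulVec, mul_adjugate, smul_mulVec, one_mulVec]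
  have hmul : fromBlocks A (replicateCol Unit c) (replicateRow Unit r) (of fun _ _ => d) *
      fromBlocks 1 (replicateCol Unit (-(A.adjugate *ᵥ c))) 0 (of fun _ _ => A.det) =
      fromBlocks A 0 (replicateRow Unit r) (of fun _ _ => d * A.det - r ⬝ᵥ (A.adjugate *ᵥ c)) := by
    rw [fromBlocks_multiply]
    congr 1
    · simp
    · ext i j
      have hneg := congrFun (mulVec_neg (A.adjugate *ᵥ c) A) i
      rw [hAadj] at hneg
      have hcol : (A * replicateCol Unit (-(A.adjugate *ᵥ c))) i j = -(A.det * c i) := hneg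
      rw [Matrix.add_apply, hcol]
      simp [Matrix.mul_apply, mul_comm]
    · simp
    · ext i j
      simp [Matrix.mul_apply, dotProduct, sub_eq_add_neg, add_comm]
  have hdet := congrArg det hmul
  rw [det_mul, det_fromBlocks_zero₂₁, det_fromBlocks_zero₁₂] at hdet
  simpa only [det_one, one_mul, det_unique, of_apply, mul_comm A.det] using hdet

theorem det_fromBlocks_bordered {n R : Type*} [Fintype n] [DecidableEq n] [CommRing R]
    (A : Matrix n n R) (c r : n → R) (d : R) :
    (fromBlocks A (replicateCol Unit c) (replicateRow Unit r) (of fun _ _ => d)).det =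
      d * A.det - r ⬝ᵥ (A.adjugate *ᵥ c) := by
  -- `X + A` over `R[X]` has a monic, hence cancellable, determinant and specialises to `A` at `0`.
  have hreg : IsLeftRegular (charmatrix (-A)).det := (charpoly_monic (-A)).isRegular.left
  have heval : (evalRingHom 0).mapMatrix (charmatrix (-A)) = A := by
    ext i j
    by_cases hij : i = j
    · subst hij; simp [charmatrix_apply_eq]
    · simp [charmatrix_apply_ne _ _ _ hij]
  have hadj : (charmatrix (-A)).adjugate.map (evalRingHom 0) = A.adjugate := by
    rw [← RingHom.mapMatrix_apply, RingHom.map_adjugate, heval]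
  have hblocks : (evalRingHom 0).mapMatrix (fromBlocks (charmatrix (-A))
      (replicateCol Unit (Polynomial.C ∘ c)) (replicateRow Unit (Polynomial.C ∘ r))
      (of fun _ _ => Polynomial.C d)) =
      fromBlocks A (replicateCol Unit c) (replicateRow Unit r) (of fun _ _ => d) := by
    conv_rhs => rw [← heval]
    ext (i | i) (j | j) <;> simp
  have hC (v : n → R) : evalRingHom 0 ∘ Polynomial.C ∘ v = v := by ext; simp
  have hmulVec : evalRingHom 0 ∘ ((charmatrix (-A)).adjugate *ᵥ (Polynomial.C ∘ c)) =
      A.adjugate *ᵥ c := by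
    ext i
    rw [Function.comp_apply, RingHom.map_mulVec, hadj, hC]
  have h := congrArg (evalRingHom 0) <| hreg <| det_mul_det_fromBlocks_bordered
    (charmatrix (-A)) (Polynomial.C ∘ c) (Polynomial.C ∘ r) (Polynomial.C d)
  rwa [RingHom.map_det, hblocks, map_sub, map_mul, RingHom.map_det, heval,
    RingHom.map_dotProduct, hmulVec, hC, coe_evalRingHom, eval_C] at h

theorem det_fromBlocks_lowerRight_zero {n R : Type*} [Fintype n] [DecidableEq n] [CommRing R]
    (A B C : Matrix n n R) :
    (fromBlocks A B C 0).det = (-1) ^ Fintype.card n * (B.det * C.det) := by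
  have hrot : fromBlocks A B C 0 *
      (fromBlocks 1 (-1) 0 1 * fromBlocks 1 0 1 1 * fromBlocks 1 (-1) 0 1) =
      fromBlocks B (-A) 0 (-C) := by
    simp [fromBlocks_multiply]
  have hdet := congrArg det hrot
  simp only [det_mul, det_fromBlocks_zero₂₁, det_fromBlocks_zero₁₂, det_one, mul_one, det_neg]
    at hdet
  rw [hdet, mul_left_comm]

theorem prodDiff_eq_det_vandermonde {N : ℕ} (z : Fin N → ℝ) :
    prodDiff z = (vandermonde z).det := by
  rw [det_vandermonde]; rfl

theorem det_eval_eq_prod_coeff_mul_det_vandermonde {R : Type*} [CommRing R] {N : ℕ}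
    (z : Fin N → R) (p : Fin N → R[X]) (hp : ∀ i, (p i).natDegree ≤ i) :
    (of fun i j => (p j).eval (z i)).det = (∏ i, (p i).coeff i) * (vandermonde z).det := by
  rw [mul_comm, eval_matrixOfPolynomials_eq_vandermonde_mul_matrixOfPolynomials z p hp, det_mul]
  congr 1
  refine det_of_isUpperTriangular (M := of fun i j : Fin N => (p j).coeff i) fun i j hij => ?_
  exact coeff_eq_zero_of_natDegree_lt (lt_of_le_of_lt (hp j) hij)

theorem eval_eq_eval_nodal_mul_sum {F ι : Type*} [Field F] [DecidableEq ι] {s : Finset ι}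
    {v : ι → F} (hv : Set.InjOn v s) {f : F[X]} (hf : f.degree < s.card) {x : F}
    (hx : ∀ i ∈ s, x ≠ v i) :
    f.eval x = (Lagrange.nodal s v).eval x *
      ∑ i ∈ s, Lagrange.nodalWeight s v i * (x - v i)⁻¹ * f.eval (v i) := by
  conv_lhs => rw [Lagrange.eq_interpolate hv hf]
  exact Lagrange.eval_interpolate_not_at_node _ hx

theorem prod_nodalWeight_mul_det_vandermonde_sq {F : Type*} [Field F] {N : ℕ} {v : Fin N → F}
    (hv : Function.Injective v) :
    (∏ i, Lagrange.nodalWeight Finset.univ v i) *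
      ((vandermonde v).det * (vandermonde (-v)).det) = 1 := by
  have hoff : (vandermonde v).det * (vandermonde (-v)).det =
      ∏ i, ∏ j ∈ Finset.univ.erase i, (v i - v j) := by
    simp only [det_vandermonde, ← Finset.prod_mul_distrib, Finset.erase_eq, Pi.neg_apply,
      ← Finset.compl_eq_univ_sdiff, neg_sub_neg]
    rw [← Finset.prod_prod_Ioi_mul_eq_prod_prod_off_diag (fun j i => v i - v j)]
    simp only [mul_comm]
  have hne : (vandermonde v).det * (vandermonde (-v)).det ≠ 0 :=
    mul_ne_zero (det_vandermonde_ne_zero_iff.2 hv)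
      (det_vandermonde_ne_zero_iff.2 (neg_injective.comp hv))
  simp only [Lagrange.nodalWeight, Finset.prod_inv_distrib, ← hoff]
  exact inv_mul_cancel₀ hne

theorem vandermonde_eq_diagonal_mul_cauchy_mul {F : Type*} [Field F] {N : ℕ} {x y : Fin N → F}
    (hy : Function.Injective y) (h : ∀ i j, x i + y j ≠ 0) :
    vandermonde x = diagonal (fun i => ∏ k, (x i + y k)) * of (fun i j => 1 / (x i + y j)) *
      diagonal (Lagrange.nodalWeight Finset.univ (-y)) * vandermonde (-y) := by
  ext i m
  have hdeg : (X ^ (m : ℕ) : F[X]).degree < (Finset.univ : Finset (Fin N)).card := by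
    rw [degree_X_pow, Finset.card_univ, Fintype.card_fin]
    exact_mod_cast m.is_lt
  have hlag := eval_eq_eval_nodal_mul_sum (x := x i) (v := -y) (s := Finset.univ)
    (neg_injective.comp hy).injOn hdeg fun j _ heq => h i j (by simp [heq])
  simp only [Lagrange.eval_nodal, eval_pow, eval_X, Pi.neg_apply, sub_neg_eq_add] at hlag
  rw [vandermonde_apply, hlag, Finset.mul_sum, Matrix.mul_apply]
  refine Finset.sum_congr rfl fun j _ => ?_
  rw [mul_diagonal, diagonal_mul, of_apply, vandermonde_apply, Pi.neg_apply, one_div]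
  ring

theorem det_cauchy {F : Type*} [Field F] {N : ℕ} (x y : Fin N → F) (h : ∀ i j, x i + y j ≠ 0) :
    (of fun i j => 1 / (x i + y j)).det =
      (vandermonde x).det * (vandermonde y).det / ∏ i, ∏ j, (x i + y j) := by
  by_cases hy : Function.Injective y
  · have hprod : ∏ i, ∏ j, (x i + y j) ≠ 0 := by simpa [Finset.prod_ne_zero_iff] using h
    have hw := prod_nodalWeight_mul_det_vandermonde_sq (neg_injective.comp hy)
    have hdet := congrArg det (vandermonde_eq_diagonal_mul_cauchy_mul hy h)
    simp only [det_mul, det_diagonal] at hdet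
    rw [eq_div_iff hprod, hdet]
    change (∏ i, Lagrange.nodalWeight Finset.univ (-y) i) *
      ((vandermonde (-y)).det * (vandermonde (- -y)).det) = 1 at hw
    rw [neg_neg] at hw
    linear_combination (-(of fun i j => 1 / (x i + y j)).det * ∏ i, ∏ j, (x i + y j)) * hw
  · obtain ⟨i, j, hij, hne⟩ : ∃ i j, y i = y j ∧ i ≠ j := by
      simpa [Function.Injective] using hy
    have hvand : (vandermonde y).det = 0 := by
      rw [← not_ne_iff, det_vandermonde_ne_zero_iff]
      exact hy
    rw [det_zero_of_column_eq hne (by simp [hij]), hvand, mul_zero, zero_div]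

theorem abs_det_le_of_abs_le_mul {n R : Type*} [Fintype n] [DecidableEq n] [CommRing R]
    [LinearOrder R] [IsStrictOrderedRing R] (M : Matrix n n R) (g h : n → R)
    (hM : ∀ i j, |M i j| ≤ g i * h j) :
    |M.det| ≤ (Fintype.card n).factorial * ((∏ i, g i) * ∏ i, h i) := by
  have hterm (σ : Equiv.Perm n) :
      |Equiv.Perm.sign σ • ∏ i, M (σ i) i| ≤ (∏ i, g i) * ∏ i, h i := by
    have habs : |Equiv.Perm.sign σ • ∏ i, M (σ i) i| = ∏ i, |M (σ i) i| := by
      rw [← Finset.abs_prod]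
      exact AbsoluteValue.abs.map_units_int_smul _ _
    rw [habs, ← Equiv.prod_comp σ g, ← Finset.prod_mul_distrib]
    exact Finset.prod_le_prod (fun i _ => abs_nonneg _) fun i _ => hM _ _
  calc |M.det| ≤ ∑ σ : Equiv.Perm n, |Equiv.Perm.sign σ • ∏ i, M (σ i) i| := by
        rw [det_apply]; exact Finset.abs_sum_le_sum_abs _ _
    _ ≤ ∑ _σ : Equiv.Perm n, (∏ i, g i) * ∏ i, h i := Finset.sum_le_sum fun σ _ => hterm σ
    _ = _ := by rw [Finset.sum_const, Finset.card_univ, Fintype.card_perm, nsmul_eq_mul]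

theorem measurable_det {α n : Type*} [MeasurableSpace α] [Fintype n] [DecidableEq n]
    {M : α → Matrix n n ℝ} (hM : ∀ i j, Measurable fun a => M a i j) :
    Measurable fun a => (M a).det := by
  simp_rw [det_apply']
  fun_prop

end Determinants

/-! ### Bi-orthogonal systems -/

section BiorthogonalSystems

open Matrix

/-- The tuple with entries `x i` in the positions `e (inl i)` and `x' j` in the positions
`e (inr j)`. -/
def glue {ι κ η α : Type*} (e : ι ⊕ κ ≃ η) (x : ι → α) (x' : κ → α) : η → α :=
  Sum.elim x x' ∘ e.symm

/-- Functions `p n` of `x` and `q n` of `y`, for `n < N`, which are bi-orthonormal with respect to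
the pairing `∬ p(x) C(x, y) q(y) dμ(x) dν(y)`. The majorants `φ` and `ψ` make all the integrals
built from these data converge absolutely. -/
structure BiorthogonalSystem {α β : Type*} [MeasurableSpace α] [MeasurableSpace β]
    (μ : Measure α) (ν : Measure β) (N : ℕ) where
  C : α → β → ℝ
  p : Fin N → α → ℝ
  q : Fin N → β → ℝ
  φ : α → ℝ
  ψ : β → ℝ
  measurable_C : Measurable (Function.uncurry C)
  measurable_p : ∀ n, Measurable (p n)
  measurable_q : ∀ n, Measurable (q n)
  abs_C_le : ∀ x y, |C x y| ≤ φ x * ψ y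
  integrable_p_mul_φ : ∀ n, Integrable (fun x => p n x * φ x) μ
  integrable_q_mul_ψ : ∀ n, Integrable (fun y => q n y * ψ y) ν
  biorthogonal : ∀ n m, ∫ z, p n z.1 * C z.1 z.2 * q m z.2 ∂(μ.prod ν) = if n = m then 1 else 0

namespace BiorthogonalSystem

variable {α β : Type*} [MeasurableSpace α] [MeasurableSpace β] {μ : Measure α} {ν : Measure β}
  {N : ℕ} (S : BiorthogonalSystem μ ν N)

/-- The system with the two kinds of variables exchanged. -/
def swap [SFinite μ] [SFinite ν] : BiorthogonalSystem ν μ N where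
  C x y := S.C y x
  p := S.q
  q := S.p
  φ := S.ψ
  ψ := S.φ
  measurable_C := S.measurable_C.comp measurable_swap
  measurable_p := S.measurable_q
  measurable_q := S.measurable_p
  abs_C_le x y := by rw [mul_comm]; exact S.abs_C_le y x
  integrable_p_mul_φ := S.integrable_q_mul_ψ
  integrable_q_mul_ψ := S.integrable_p_mul_φ
  biorthogonal n m := by
    rw [← integral_prod_swap]
    simp_rw [eq_comm (a := n), ← S.biorthogonal m n]
    refine integral_congr_ae (.of_forall fun z => ?_)
    simp only [Prod.fst_swap, Prod.snd_swap]
    ring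

/-- The transform `∫ p_n(x) C(x, y) dμ(x)`. -/
def leftTransform (n : Fin N) (y : β) : ℝ := ∫ x, S.p n x * S.C x y ∂μ

/-- The transform `∫ q_n(y) C(x, y) dν(y)`. -/
def rightTransform (n : Fin N) (x : α) : ℝ := ∫ y, S.q n y * S.C x y ∂ν

theorem measurable_leftTransform [SFinite μ] (n : Fin N) : Measurable (S.leftTransform n) :=
  (StronglyMeasurable.integral_prod_left (f := fun x y => S.p n x * S.C x y)
    (((S.measurable_p n).comp measurable_fst).mul S.measurable_C).stronglyMeasurable).measurable

theorem measurable_rightTransform [SFinite ν] (n : Fin N) : Measurable (S.rightTransform n) :=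
  (StronglyMeasurable.integral_prod_right (f := fun x y => S.q n y * S.C x y)
    (((S.measurable_q n).comp measurable_snd).mul S.measurable_C).stronglyMeasurable).measurable

theorem integrable_p_mul_C (n : Fin N) (y : β) : Integrable (fun x => S.p n x * S.C x y) μ := by
  refine ((S.integrable_p_mul_φ n).mul_const (S.ψ y)).mono
    ((S.measurable_p n).mul (S.measurable_C.comp measurable_prodMk_right)).aestronglyMeasurable
    (.of_forall fun x => ?_)
  rw [mul_assoc, norm_mul, norm_mul]
  exact mul_le_mul_of_nonneg_left ((S.abs_C_le x y).trans (le_abs_self _)) (norm_nonneg _)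

theorem integrable_q_mul_C (n : Fin N) (x : α) : Integrable (fun y => S.q n y * S.C x y) ν := by
  refine ((S.integrable_q_mul_ψ n).const_mul (S.φ x)).mono
    ((S.measurable_q n).mul (S.measurable_C.comp measurable_prodMk_left)).aestronglyMeasurable
    (.of_forall fun y => ?_)
  rw [mul_left_comm, norm_mul, norm_mul]
  exact mul_le_mul_of_nonneg_left ((S.abs_C_le x y).trans (le_abs_self _)) (norm_nonneg _)

theorem integrable_p_mul_C_mul_q [SFinite ν] (n m : Fin N) :
    Integrable (fun z : α × β => S.p n z.1 * S.C z.1 z.2 * S.q m z.2) (μ.prod ν) := by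
  refine ((S.integrable_p_mul_φ n).mul_prod (S.integrable_q_mul_ψ m)).mono
    ((((S.measurable_p n).comp measurable_fst).mul S.measurable_C).mul
      ((S.measurable_q m).comp measurable_snd)).aestronglyMeasurable (.of_forall fun z => ?_)
  calc ‖S.p n z.1 * S.C z.1 z.2 * S.q m z.2‖ = |S.p n z.1| * |S.C z.1 z.2| * |S.q m z.2| := by
        rw [Real.norm_eq_abs, abs_mul, abs_mul]
    _ ≤ |S.p n z.1| * |S.φ z.1 * S.ψ z.2| * |S.q m z.2| := by
        gcongr |S.p n z.1| * ?_ * |S.q m z.2|; exact (S.abs_C_le _ _).trans (le_abs_self _)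
    _ = ‖S.p n z.1 * S.φ z.1 * (S.q m z.2 * S.ψ z.2)‖ := by
        simp only [Real.norm_eq_abs, abs_mul]; ring

theorem p_mul_rightTransform (n m : Fin N) (x : α) :
    S.p n x * S.rightTransform m x = ∫ y, S.p n x * S.C x y * S.q m y ∂ν := by
  rw [rightTransform, ← integral_const_mul]
  exact integral_congr_ae (.of_forall fun y => by simp only; ring)

theorem integrable_p_mul_rightTransform [SFinite ν] (n m : Fin N) :
    Integrable (fun x => S.p n x * S.rightTransform m x) μ := by
  simp_rw [p_mul_rightTransform]
  exact (S.integrable_p_mul_C_mul_q n m).integral_prod_left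

theorem integral_p_mul_rightTransform [SFinite μ] [SFinite ν] (n m : Fin N) :
    ∫ x, S.p n x * S.rightTransform m x ∂μ = if n = m then 1 else 0 := by
  simp_rw [p_mul_rightTransform]
  rw [← S.biorthogonal n m, integral_prod _ (S.integrable_p_mul_C_mul_q n m)]

theorem integrable_p_mul_sum_rightTransform [SFinite ν] (c : Fin N → ℝ) (m : Fin N) :
    Integrable (fun t => S.p m t * ∑ n, c n * S.rightTransform n t) μ := by
  simp only [Finset.mul_sum, mul_left_comm _ (c _)]
  exact integrable_finsetSum _ fun n _ => (S.integrable_p_mul_rightTransform m n).const_mul (c n)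

theorem integral_p_mul_sum_rightTransform [SFinite μ] [SFinite ν] (c : Fin N → ℝ) (m : Fin N) :
    ∫ t, S.p m t * ∑ n, c n * S.rightTransform n t ∂μ = c m := by
  simp only [Finset.mul_sum, mul_left_comm _ (c _)]
  rw [integral_finsetSum _ fun n _ => (S.integrable_p_mul_rightTransform m n).const_mul (c n)]
  simp [integral_const_mul, integral_p_mul_rightTransform]

section CorrelationMatrix

variable {ι κ : Type*}

/-- The block matrix whose determinant gives the correlation functions of the point process with
density proportional to `det[p_n(x_i)] det[q_n(y_i)] det[C(x_i, y_j)]`. -/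
def correlationMatrix (x : ι → α) (y : κ → β) : Matrix (ι ⊕ κ) (ι ⊕ κ) ℝ :=
  fromBlocks
    (of fun i j => ∑ n, S.p n (x i) * S.rightTransform n (x j))
    (of fun i j => ∑ n, S.p n (x i) * S.q n (y j))
    (of fun i j => ∑ n, S.leftTransform n (y i) * S.rightTransform n (x j) - S.C (x j) (y i))
    (of fun i j => ∑ n, S.leftTransform n (y i) * S.q n (y j))

/-- The column of the correlation matrix that belongs to an additional variable `t`. -/
def borderColumn (x : ι → α) (y : κ → β) (t : α) : ι ⊕ κ → ℝ :=
  Sum.elim (fun i => ∑ n, S.p n (x i) * S.rightTransform n t)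
    (fun j => ∑ n, S.leftTransform n (y j) * S.rightTransform n t - S.C t (y j))

/-- The coefficient of `p_n(t)` in the row of the correlation matrix that belongs to an additional
variable `t`. -/
def borderRow (x : ι → α) (y : κ → β) (n : Fin N) : ι ⊕ κ → ℝ :=
  Sum.elim (fun i => S.rightTransform n (x i)) (fun j => S.q n (y j))

theorem integrable_p_mul_borderColumn [SFinite ν] (x : ι → α) (y : κ → β) (m : Fin N) (i : ι ⊕ κ) :
    Integrable (fun t => S.p m t * S.borderColumn x y t i) μ := by
  rcases i with i | j
  · exact S.integrable_p_mul_sum_rightTransform (fun n => S.p n (x i)) m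
  · simp only [borderColumn, Sum.elim_inr, mul_sub]
    exact (S.integrable_p_mul_sum_rightTransform (fun n => S.leftTransform n (y j)) m).sub
      (S.integrable_p_mul_C m (y j))

theorem integral_p_mul_borderColumn [SFinite μ] [SFinite ν] (x : ι → α) (y : κ → β) (m : Fin N)
    (i : ι ⊕ κ) :
    ∫ t, S.p m t * S.borderColumn x y t i ∂μ = Sum.elim (fun i => S.p m (x i)) 0 i := by
  rcases i with i | j
  · exact S.integral_p_mul_sum_rightTransform (fun n => S.p n (x i)) m
  · simp only [borderColumn, Sum.elim_inr, mul_sub]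
    rw [integral_sub (S.integrable_p_mul_sum_rightTransform _ m) (S.integrable_p_mul_C m (y j)),
      S.integral_p_mul_sum_rightTransform (fun n => S.leftTransform n (y j)) m]
    exact sub_self _

variable [Fintype ι] [Fintype κ] [DecidableEq ι] [DecidableEq κ]

/-- The determinant of the correlation matrix. -/
def correlationDet (x : ι → α) (y : κ → β) : ℝ := (S.correlationMatrix x y).det

theorem correlationDet_comp_equiv {ι' κ' : Type*} [Fintype ι'] [Fintype κ'] [DecidableEq ι']
    [DecidableEq κ'] (x : ι → α) (y : κ → β) (e : ι' ≃ ι) (f : κ' ≃ κ) :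
    S.correlationDet (x ∘ e) (y ∘ f) = S.correlationDet x y := by
  rw [correlationDet, correlationDet, ← det_submatrix_equiv_self (Equiv.sumCongr e f)]
  congr 1
  ext (i | i) (j | j) <;> rfl

theorem correlationDet_swap [SFinite μ] [SFinite ν] (x : ι → α) (y : κ → β) :
    S.swap.correlationDet y x = S.correlationDet x y := by
  have hswap : S.swap.correlationMatrix y x =
      (S.correlationMatrix x y)ᵀ.submatrix (Equiv.sumComm κ ι) (Equiv.sumComm κ ι) := by
    have hcomm (f g : Fin N → ℝ) : ∑ n, f n * g n = ∑ n, g n * f n :=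
      Finset.sum_congr rfl fun n _ => mul_comm _ _
    ext (i | i) (j | j)
    · exact hcomm _ _
    · exact hcomm _ _
    · exact congrArg (· - _) (hcomm _ _)
    · exact hcomm _ _
  rw [correlationDet, hswap, det_submatrix_equiv_self, det_transpose, correlationDet]

theorem measurable_correlationDet [SFinite μ] [SFinite ν] :
    Measurable fun z : (ι → α) × (κ → β) => S.correlationDet z.1 z.2 := by
  have hp n i : Measurable fun z : (ι → α) × (κ → β) => S.p n (z.1 i) :=
    (S.measurable_p n).comp (by fun_prop)
  have hq n i : Measurable fun z : (ι → α) × (κ → β) => S.q n (z.2 i) :=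
    (S.measurable_q n).comp (by fun_prop)
  have hleft n i : Measurable fun z : (ι → α) × (κ → β) => S.leftTransform n (z.2 i) :=
    (S.measurable_leftTransform n).comp (by fun_prop)
  have hright n i : Measurable fun z : (ι → α) × (κ → β) => S.rightTransform n (z.1 i) :=
    (S.measurable_rightTransform n).comp (by fun_prop)
  have hC i j : Measurable fun z : (ι → α) × (κ → β) => S.C (z.1 j) (z.2 i) :=
    S.measurable_C.comp (f := fun z : (ι → α) × (κ → β) => (z.1 j, z.2 i)) (by fun_prop)
  refine measurable_det fun i j => ?_
  rcases i with i | i <;> rcases j with j | j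
  · exact Finset.univ.measurable_fun_sum fun n _ => (hp n i).mul (hright n j)
  · exact Finset.univ.measurable_fun_sum fun n _ => (hp n i).mul (hq n j)
  · exact (Finset.univ.measurable_fun_sum fun n _ => (hleft n i).mul (hright n j)).sub (hC i j)
  · exact Finset.univ.measurable_fun_sum fun n _ => (hleft n i).mul (hq n j)

theorem correlationDet_sumElim_unit (x : ι → α) (y : κ → β) (t : α) :
    S.correlationDet (Sum.elim x fun _ : Unit => t) y =
      ∑ n, (S.p n t * S.rightTransform n t * S.correlationDet x y -
        (S.borderRow x y n ᵥ* (S.correlationMatrix x y).adjugate) ⬝ᵥ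
          fun i => S.p n t * S.borderColumn x y t i) := by
  let e : (ι ⊕ κ) ⊕ Unit ≃ (ι ⊕ Unit) ⊕ κ :=
    (Equiv.sumAssoc ι κ Unit).trans (((Equiv.refl ι).sumCongr (Equiv.sumComm κ Unit)).trans
      (Equiv.sumAssoc ι Unit κ).symm)
  have hborder : (S.correlationMatrix (Sum.elim x fun _ : Unit => t) y).submatrix e e =
      fromBlocks (S.correlationMatrix x y) (replicateCol Unit (S.borderColumn x y t))
        (replicateRow Unit (∑ n, S.p n t • S.borderRow x y n))
        (of fun _ _ => ∑ n, S.p n t * S.rightTransform n t) := by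
    ext ((i | i) | i) ((j | j) | j) <;> simp [e, correlationMatrix, borderColumn, borderRow]
  rw [correlationDet, ← det_submatrix_equiv_self e, hborder, det_fromBlocks_bordered,
    sum_dotProduct, Finset.sum_mul, ← Finset.sum_sub_distrib]
  refine Finset.sum_congr rfl fun n _ => ?_
  rw [smul_dotProduct, dotProduct_mulVec, ← dotProduct_smul]
  rfl

theorem sum_borderRow_vecMul_adjugate_dotProduct (x : ι → α) (y : κ → β) :
    ∑ n, (S.borderRow x y n ᵥ* (S.correlationMatrix x y).adjugate) ⬝ᵥ
        Sum.elim (fun i => S.p n (x i)) 0 =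
      Fintype.card ι * S.correlationDet x y := by
  have hrow (j : ι) : ∑ n, S.p n (x j) • S.borderRow x y n =
      S.correlationMatrix x y (Sum.inl j) := by
    ext (i | i) <;> simp [correlationMatrix, borderRow]
  have hdiag (j : ι) : ∑ n, (S.borderRow x y n ᵥ* (S.correlationMatrix x y).adjugate) (Sum.inl j) *
      S.p n (x j) = S.correlationDet x y := by
    calc _ = ((∑ n, S.p n (x j) • S.borderRow x y n) ᵥ*
          (S.correlationMatrix x y).adjugate) (Sum.inl j) := by
          simp [sum_vecMul, smul_vecMul, mul_comm]
      _ = (S.correlationMatrix x y * (S.correlationMatrix x y).adjugate)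
          (Sum.inl j) (Sum.inl j) := by rw [hrow]; rfl
      _ = S.correlationDet x y := by simp [mul_adjugate, correlationDet]
  simp only [dotProduct, Fintype.sum_sum_type, Sum.elim_inl, Sum.elim_inr, Pi.zero_apply,
    mul_zero, Finset.sum_const_zero, add_zero]
  rw [Finset.sum_comm, Finset.sum_congr rfl fun j _ => hdiag j]
  simp

theorem integral_correlationDet_sumElim_unit [SFinite μ] [SFinite ν] (x : ι → α) (y : κ → β) :
    ∫ t, S.correlationDet (Sum.elim x fun _ : Unit => t) y ∂μ =
      (N - Fintype.card ι) * S.correlationDet x y := by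
  have hcorner n := (S.integrable_p_mul_rightTransform n n).mul_const (S.correlationDet x y)
  have hentry n i := S.integrable_p_mul_borderColumn x y n i
  have hborder (n : Fin N) (u : ι ⊕ κ → ℝ) :
      Integrable (fun t => u ⬝ᵥ fun i => S.p n t * S.borderColumn x y t i) μ :=
    integrable_finsetSum _ fun i _ => (hentry n i).const_mul (u i)
  have hintegral (n : Fin N) (u : ι ⊕ κ → ℝ) :
      ∫ t, u ⬝ᵥ (fun i => S.p n t * S.borderColumn x y t i) ∂μ =
        u ⬝ᵥ Sum.elim (fun i => S.p n (x i)) 0 := by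
    simp only [dotProduct]
    rw [integral_finsetSum _ fun i _ => (hentry n i).const_mul (u i)]
    simp_rw [integral_const_mul, integral_p_mul_borderColumn]
  simp_rw [correlationDet_sumElim_unit]
  rw [integral_finsetSum Finset.univ fun n _ => show Integrable (fun t => _ - _) μ from
    (hcorner n).sub (hborder n _)]
  simp_rw [integral_sub (hcorner _) (hborder _ _), integral_mul_const,
    integral_p_mul_rightTransform, hintegral, Finset.sum_sub_distrib,
    sum_borderRow_vecMul_adjugate_dotProduct]
  simp [sub_mul]

end CorrelationMatrix

end BiorthogonalSystem

theorem measurable_glue {ι κ η α : Type*} [MeasurableSpace α] (e : ι ⊕ κ ≃ η) (x : ι → α) :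
    Measurable (glue e x : (κ → α) → η → α) := by
  refine measurable_pi_lambda _ fun i => ?_
  simp only [glue, Function.comp_apply]
  rcases e.symm i with j | j
  · exact measurable_const
  · exact measurable_pi_apply j

theorem prod_comp_glue {ι κ η α M : Type*} [Fintype ι] [Fintype κ] [Fintype η] [CommMonoid M]
    (e : ι ⊕ κ ≃ η) (g : α → M) (x : ι → α) (x' : κ → α) :
    ∏ i, g (glue e x x' i) = (∏ i, g (x i)) * ∏ j, g (x' j) := by
  simp only [glue, Function.comp_apply]
  rw [e.symm.prod_comp fun i => g (Sum.elim x x' i), Fintype.prod_sum_type]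
  rfl

theorem glue_emptySum {ι κ γ : Type*} [IsEmpty ι] (x : ι → γ) (x' : κ → γ) :
    glue (Equiv.emptySum ι κ) x x' = x' := by
  rw [glue, Equiv.comp_symm_eq]
  ext (i | i)
  · exact isEmptyElim i
  · rfl

namespace BiorthogonalSystem

variable {α β : Type*} [MeasurableSpace α] [MeasurableSpace β] {μ : Measure α} {ν : Measure β}
  {N : ℕ} (S : BiorthogonalSystem μ ν N)

section Factorization

theorem correlationDet_eq_det_mul_det_mul_det (x : Fin N → α) (y : Fin N → β) :
    S.correlationDet x y = (of fun i n => S.p n (x i)).det * (of fun i n => S.q n (y i)).det *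
      (of fun i j => S.C (x i) (y j)).det := by
  have hfactor : S.correlationMatrix x y =
      fromBlocks (of fun i n => S.p n (x i)) 0 (of fun i n => S.leftTransform n (y i)) (-1) *
      fromBlocks (of fun n j => S.rightTransform n (x j)) (of fun i n => S.q n (y i))ᵀ
        (of fun i j => S.C (x i) (y j))ᵀ 0 := by
    rw [fromBlocks_multiply]
    ext (i | i) (j | j) <;> simp [correlationMatrix, Matrix.mul_apply, sub_eq_add_neg]
  have hsign : ((-1 : ℝ) ^ N) * (-1) ^ N = 1 := by rw [← mul_pow]; simp
  rw [correlationDet, hfactor, det_mul, det_fromBlocks_zero₁₂, det_fromBlocks_lowerRight_zero,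
    det_transpose, det_transpose, det_neg, det_one, Fintype.card_fin]
  linear_combination ((of fun i n => S.p n (x i)).det * (of fun i n => S.q n (y i)).det *
      (of fun i j => S.C (x i) (y j)).det) * hsign

/-- An integrable majorant of all the functions `p n * φ`. -/
def majorant (x : α) : ℝ := ∑ n, |S.p n x * S.φ x|

theorem integrable_majorant : Integrable S.majorant μ :=
  integrable_finsetSum _ fun n _ => (S.integrable_p_mul_φ n).abs

theorem abs_det_p_mul_prod_le (x : Fin N → α) :
    |(of fun i n => S.p n (x i)).det * ∏ i, S.φ (x i)| ≤
      N.factorial * ∏ i, S.majorant (x i) := by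
  rw [mul_comm, ← det_mul_column]
  refine (abs_det_le_of_abs_le_mul _ (fun i => S.majorant (x i)) 1 fun i n => ?_).trans_eq
    (by simp)
  rw [of_apply, of_apply, Pi.one_apply, mul_one, mul_comm]
  exact Finset.single_le_sum (f := fun n => |S.p n (x i) * S.φ (x i)|)
    (fun _ _ => abs_nonneg _) (Finset.mem_univ n)

theorem abs_correlationDet_le [SFinite μ] [SFinite ν] (x : Fin N → α) (y : Fin N → β) :
    |S.correlationDet x y| ≤
      N.factorial ^ 3 * ((∏ i, S.majorant (x i)) * ∏ i, S.swap.majorant (y i)) := by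
  have hC := abs_det_le_of_abs_le_mul (of fun i j => S.C (x i) (y j)) (fun i => S.φ (x i))
    (fun i => S.ψ (y i)) fun i j => S.abs_C_le _ _
  have hp := S.abs_det_p_mul_prod_le x
  have hq := S.swap.abs_det_p_mul_prod_le y
  rw [Fintype.card_fin] at hC
  rw [correlationDet_eq_det_mul_det_mul_det, abs_mul]
  calc _ ≤ |(of fun i n => S.p n (x i)).det * (of fun i n => S.q n (y i)).det| *
        |N.factorial * ((∏ i, S.φ (x i)) * ∏ i, S.ψ (y i))| := by
        exact mul_le_mul_of_nonneg_left (hC.trans (le_abs_self _)) (abs_nonneg _)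
    _ = N.factorial * (|(of fun i n => S.p n (x i)).det * ∏ i, S.φ (x i)| *
          |(of fun i n => S.q n (y i)).det * ∏ i, S.ψ (y i)|) := by
        simp only [abs_mul, Nat.abs_cast]; ring
    _ ≤ N.factorial * ((N.factorial * ∏ i, S.majorant (x i)) *
          (N.factorial * ∏ i, S.swap.majorant (y i))) := by
        exact mul_le_mul_of_nonneg_left (mul_le_mul hp hq (abs_nonneg _)
          ((abs_nonneg _).trans hp)) (Nat.cast_nonneg _)
    _ = _ := by ring

theorem integrable_correlationDet_glue [SigmaFinite μ] [SigmaFinite ν] {ι κ ι' κ' : Type*}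
    [Fintype ι'] [Fintype κ'] (e : ι ⊕ ι' ≃ Fin N) (f : κ ⊕ κ' ≃ Fin N)
    (x : ι → α) (y : κ → β) :
    Integrable (fun z : (ι' → α) × (κ' → β) => S.correlationDet (glue e x z.1) (glue f y z.2))
      ((Measure.pi fun _ => μ).prod (Measure.pi fun _ => ν)) := by
  have := Fintype.ofInjective _ (e.injective.comp Sum.inl_injective)
  have := Fintype.ofInjective _ (f.injective.comp Sum.inl_injective)
  have hx : Integrable (fun x' : ι' → α => ∏ i, S.majorant (x' i)) (Measure.pi fun _ => μ) :=
    .fintype_prod fun _ => S.integrable_majorant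
  have hy : Integrable (fun y' : κ' → β => ∏ i, S.swap.majorant (y' i))
      (Measure.pi fun _ => ν) := .fintype_prod fun _ => S.swap.integrable_majorant
  refine ((hx.mul_prod hy).const_mul (N.factorial ^ 3 * ((∏ i, S.majorant (x i)) *
    ∏ i, S.swap.majorant (y i)))).mono' (S.measurable_correlationDet.comp
      (((measurable_glue e x).comp measurable_fst).prodMk
        ((measurable_glue f y).comp measurable_snd))).aestronglyMeasurable
    (.of_forall fun z => (S.abs_correlationDet_le _ _).trans_eq ?_)
  rw [prod_comp_glue, prod_comp_glue]
  ring

end Factorization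

section IntegrateOut

variable {ι κ : Type*} [Fintype ι] [Fintype κ] [DecidableEq ι] [DecidableEq κ]

theorem correlationDet_sumElim_cons {k : ℕ} (x : ι → α) (t : α) (x' : Fin k → α) (y : κ → β) :
    S.correlationDet (Sum.elim x (Fin.cons t x' : Fin (k + 1) → α)) y =
      S.correlationDet (Sum.elim (Sum.elim x fun _ : Unit => t) x') y := by
  let e : (ι ⊕ Unit) ⊕ Fin k ≃ ι ⊕ Fin (k + 1) :=
    (Equiv.sumAssoc ι Unit (Fin k)).trans (Equiv.sumCongr (Equiv.refl ι)
      ((Equiv.sumComm Unit (Fin k)).trans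
        ((Equiv.optionEquivSumPUnit (Fin k)).symm.trans (finSuccEquiv k).symm)))
  rw [← S.correlationDet_comp_equiv _ y e (Equiv.refl κ)]
  congr 1
  ext ((i | i) | i) <;> simp [e]

theorem integral_correlationDet_sumElim [SigmaFinite μ] [SFinite ν] (y : κ → β) {k : ℕ}
    (x : ι → α) (hk : Fintype.card ι + k = N)
    (hint : Integrable (fun x' : Fin k → α => S.correlationDet (Sum.elim x x') y)
      (Measure.pi fun _ => μ)) :
    ∫ x' : Fin k → α, S.correlationDet (Sum.elim x x') y ∂(Measure.pi fun _ => μ) =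
      k.factorial * S.correlationDet x y := by
  induction k generalizing ι with
  | zero =>
    have hempty (x' : Fin 0 → α) : S.correlationDet (Sum.elim x x') y = S.correlationDet x y := by
      rw [← S.correlationDet_comp_equiv x y (Equiv.sumEmpty ι (Fin 0)) (Equiv.refl κ)]
      congr 1
      ext (i | i)
      · rfl
      · exact i.elim0
    simp [hempty, measureReal_def]
  | succ k ih =>
    have hcons := (measurePreserving_piFinSuccAbove (fun _ : Fin (k + 1) => μ) 0).symm
    have hsplit (z : α × (Fin k → α)) :
        S.correlationDet
          (Sum.elim x ((MeasurableEquiv.piFinSuccAbove (fun _ => α) 0).symm z)) y =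
          S.correlationDet (Sum.elim (Sum.elim x fun _ : Unit => z.1) z.2) y := by
      rw [← S.correlationDet_sumElim_cons]
      congr 2
      exact Fin.insertNth_zero' _ _
    have hint' : Integrable (fun z : α × (Fin k → α) =>
        S.correlationDet (Sum.elim (Sum.elim x fun _ : Unit => z.1) z.2) y)
        (μ.prod (Measure.pi fun _ => μ)) := by
      simp_rw [← hsplit]
      exact (hcons.integrable_comp_emb (MeasurableEquiv.measurableEmbedding _)).2 hint
    have hinner : ∀ᵐ t ∂μ, ∫ x' : Fin k → α,
        S.correlationDet (Sum.elim (Sum.elim x fun _ : Unit => t) x') y ∂(Measure.pi fun _ => μ) =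
          k.factorial * S.correlationDet (Sum.elim x fun _ : Unit => t) y := by
      filter_upwards [hint'.prod_right_ae] with t ht
      exact ih _ (by simp; omega) ht
    have hcard : (N : ℝ) - Fintype.card ι = k + 1 := by rw [← hk]; push_cast; ring
    rw [← hcons.integral_comp (MeasurableEquiv.measurableEmbedding _)]
    simp_rw [hsplit]
    rw [integral_prod _ hint', integral_congr_ae hinner, integral_const_mul,
      S.integral_correlationDet_sumElim_unit, hcard]
    push_cast [Nat.factorial_succ]
    ring

theorem integral_correlationDet_glue [SigmaFinite μ] [SigmaFinite ν] {k l : ℕ}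
    (e : ι ⊕ Fin k ≃ Fin N) (f : κ ⊕ Fin l ≃ Fin N) (x : ι → α) (y : κ → β) :
    ∫ z : (Fin k → α) × (Fin l → β), S.correlationDet (glue e x z.1) (glue f y z.2)
        ∂((Measure.pi fun _ => μ).prod (Measure.pi fun _ => ν)) =
      k.factorial * l.factorial * S.correlationDet x y := by
  have hint := S.integrable_correlationDet_glue e f x y
  simp only [glue, correlationDet_comp_equiv] at hint ⊢
  have hinner : ∀ᵐ y' : Fin l → β ∂(Measure.pi fun _ => ν), ∫ x' : Fin k → α,
      S.correlationDet (Sum.elim x x') (Sum.elim y y') ∂(Measure.pi fun _ => μ) =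
        k.factorial * S.correlationDet x (Sum.elim y y') := by
    filter_upwards [hint.prod_left_ae] with y' hy'
    exact S.integral_correlationDet_sumElim _ x (by simpa using Fintype.card_congr e) hy'
  have houter : Integrable (fun y' : Fin l → β => S.correlationDet x (Sum.elim y y'))
      (Measure.pi fun _ => ν) := by
    refine (((hint.integral_prod_right.congr hinner).const_mul
      (k.factorial : ℝ)⁻¹)).congr (.of_forall fun y' => ?_)
    exact inv_mul_cancel_left₀ (by positivity) _
  have hswap := S.swap.integral_correlationDet_sumElim (k := l) x y
    (by simpa using Fintype.card_congr f)
  simp_rw [correlationDet_swap] at hswap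
  rw [integral_prod_symm _ hint, integral_congr_ae hinner, integral_const_mul, hswap houter,
    mul_assoc]

end IntegrateOut

section FullDeterminant

variable [SigmaFinite μ] [SigmaFinite ν]

theorem integrable_correlationDet :
    Integrable (fun z : (Fin N → α) × (Fin N → β) => S.correlationDet z.1 z.2)
      ((Measure.pi fun _ => μ).prod (Measure.pi fun _ => ν)) := by
  simpa only [glue_emptySum] using S.integrable_correlationDet_glue
    (Equiv.emptySum (Fin 0) _) (Equiv.emptySum (Fin 0) _) Fin.elim0 Fin.elim0

theorem integral_correlationDet :
    ∫ z : (Fin N → α) × (Fin N → β), S.correlationDet z.1 z.2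
      ∂(Measure.pi fun _ => μ).prod (Measure.pi fun _ => ν) = (N.factorial : ℝ) ^ 2 := by
  simpa only [glue_emptySum, correlationDet, Matrix.det_isEmpty, mul_one, ← sq] using
    S.integral_correlationDet_glue (Equiv.emptySum (Fin 0) _) (Equiv.emptySum (Fin 0) _)
      Fin.elim0 Fin.elim0

end FullDeterminant

end BiorthogonalSystem

end BiorthogonalSystems

/-! ### Factorial moments -/

section FactorialMoments

open scoped ENNReal

theorem exists_equiv_extending_embedding {ι κ η : Type*} [Finite η] (e : ι ⊕ κ ≃ η) (σ : ι ↪ η) :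
    ∃ e' : ι ⊕ κ ≃ η, ∀ i, e' (Sum.inl i) = σ i := by
  classical
  let g := (Equiv.ofInjective _ (e.injective.comp Sum.inl_injective)).symm.trans
    (Equiv.ofInjective σ σ.injective)
  refine ⟨e.trans g.extendSubtype, fun i => ?_⟩
  rw [Equiv.trans_apply]
  refine (Equiv.extendSubtype_apply_of_mem g _ ⟨i, rfl⟩).trans ?_
  simp only [g, Equiv.trans_apply, Equiv.ofInjective_apply]
  exact congrArg σ ((Equiv.symm_apply_eq _).2 rfl)

theorem measurePreserving_prod_prod_prod_comm {α β γ δ : Type*} [MeasurableSpace α]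
    [MeasurableSpace β] [MeasurableSpace γ] [MeasurableSpace δ] (μ : Measure α) (ν : Measure β)
    (ξ : Measure γ) (ζ : Measure δ) [SFinite μ] [SFinite ν] [SFinite ξ] [SFinite ζ] :
    MeasurePreserving (Equiv.prodProdProdComm α β γ δ) ((μ.prod ν).prod (ξ.prod ζ))
      ((μ.prod ξ).prod (ν.prod ζ)) := by
  have hcomm : MeasurePreserving _ (ν.prod (ξ.prod ζ)) (ξ.prod (ν.prod ζ)) :=
    (measurePreserving_prodAssoc ξ ν ζ).comp ((Measure.measurePreserving_swap.prod (.id ζ)).comp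
      (measurePreserving_prodAssoc ν ξ ζ).symm)
  exact (measurePreserving_prodAssoc μ ξ _).symm.comp
    (((MeasurePreserving.id μ).prod hcomm).comp (measurePreserving_prodAssoc μ ν _))

variable {ι κ η ι' κ' η' α β : Type*} [Fintype ι] [Fintype κ] [Fintype η] [Fintype ι'] [Fintype κ']
  [Fintype η'] [MeasurableSpace α] [MeasurableSpace β]

theorem measurePreserving_glue (μ : Measure α) [SigmaFinite μ] (e : ι ⊕ κ ≃ η) :
    MeasurePreserving (fun z : (ι → α) × (κ → α) => glue e z.1 z.2)
      ((Measure.pi fun _ => μ).prod (Measure.pi fun _ => μ)) (Measure.pi fun _ => μ) := by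
  convert (measurePreserving_piCongrLeft (fun _ : η => μ) e).comp
    (measurePreserving_sumPiEquivProdPi_symm (X := fun _ : ι ⊕ κ => α) fun _ => μ) using 1
  ext z i
  obtain ⟨j | j, rfl⟩ := e.surjective i <;>
    simp [glue, MeasurableEquiv.coe_piCongrLeft, Equiv.piCongrLeft_apply_apply,
      MeasurableEquiv.coe_sumPiEquivProdPi_symm]

variable {μ : Measure α} {ν : Measure β} [SigmaFinite μ] [SigmaFinite ν]

theorem lintegral_prod_glue (e : ι ⊕ κ ≃ η) (e' : ι' ⊕ κ' ≃ η')
    {F : (η → α) × (η' → β) → ℝ≥0∞} (hF : Measurable F) :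
    ∫⁻ z, F z ∂((Measure.pi fun _ => μ).prod (Measure.pi fun _ => ν)) =
      ∫⁻ w : (ι → α) × (ι' → β), ∫⁻ v : (κ → α) × (κ' → β),
          F (glue e w.1 v.1, glue e' w.2 v.2)
        ∂((Measure.pi fun _ => μ).prod (Measure.pi fun _ => ν))
        ∂((Measure.pi fun _ => μ).prod (Measure.pi fun _ => ν)) := by
  have hmp := ((measurePreserving_glue μ e).prod (measurePreserving_glue ν e')).comp
    (measurePreserving_prod_prod_prod_comm _ _ _ _)
  rw [← hmp.lintegral_comp hF]
  exact lintegral_prod _ (hF.comp hmp.measurable).aemeasurable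

theorem lintegral_comp_embedding_mul {F : (η → α) × (η' → β) → ℝ≥0∞} (hF : Measurable F)
    (hsymm : ∀ (π : Equiv.Perm η) (π' : Equiv.Perm η') z, F (z.1 ∘ π, z.2 ∘ π') = F z)
    {f : (ι → α) × (ι' → β) → ℝ≥0∞} (hf : Measurable f) (e : ι ⊕ κ ≃ η) (e' : ι' ⊕ κ' ≃ η')
    (σ : ι ↪ η) (τ : ι' ↪ η') :
    ∫⁻ z, f (z.1 ∘ σ, z.2 ∘ τ) * F z ∂((Measure.pi fun _ => μ).prod (Measure.pi fun _ => ν)) =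
      ∫⁻ w, f w * ∫⁻ v : (κ → α) × (κ' → β), F (glue e w.1 v.1, glue e' w.2 v.2)
          ∂((Measure.pi fun _ => μ).prod (Measure.pi fun _ => ν))
        ∂((Measure.pi fun _ => μ).prod (Measure.pi fun _ => ν)) := by
  obtain ⟨g, hg⟩ := exists_equiv_extending_embedding e σ
  obtain ⟨g', hg'⟩ := exists_equiv_extending_embedding e' τ
  have hrestrict (w : (ι → α) × (ι' → β)) (v : (κ → α) × (κ' → β)) :
      (glue g w.1 v.1 ∘ σ, glue g' w.2 v.2 ∘ τ) = w := by
    ext i <;> simp [glue, ← hg, ← hg']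
  have hreorder (w : (ι → α) × (ι' → β)) (v : (κ → α) × (κ' → β)) :
      F (glue g w.1 v.1, glue g' w.2 v.2) = F (glue e w.1 v.1, glue e' w.2 v.2) := by
    rw [← hsymm (g.symm.trans e) (g'.symm.trans e') (glue e w.1 v.1, glue e' w.2 v.2)]
    congr 2 <;> ext i <;> simp [glue]
  have hglue (w : (ι → α) × (ι' → β)) : Measurable fun v : (κ → α) × (κ' → β) =>
      F (glue e w.1 v.1, glue e' w.2 v.2) :=
    hF.comp (((measurable_glue e w.1).comp measurable_fst).prodMk
      ((measurable_glue e' w.2).comp measurable_snd))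
  have hmeas : Measurable fun z : (η → α) × (η' → β) => f (z.1 ∘ σ, z.2 ∘ τ) * F z :=
    (hf.comp (by fun_prop)).mul hF
  rw [lintegral_prod_glue g g' hmeas]
  refine lintegral_congr fun w => ?_
  simp only [hrestrict, hreorder]
  exact lintegral_const_mul _ (hglue w)

theorem lintegral_sum_comp_embedding_mul {F : (η → α) × (η' → β) → ℝ≥0∞} (hF : Measurable F)
    (hsymm : ∀ (π : Equiv.Perm η) (π' : Equiv.Perm η') z, F (z.1 ∘ π, z.2 ∘ π') = F z)
    {f : (ι → α) × (ι' → β) → ℝ≥0∞} (hf : Measurable f) (e : ι ⊕ κ ≃ η) (e' : ι' ⊕ κ' ≃ η')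
    [Fintype (ι ↪ η)] [Fintype (ι' ↪ η')] :
    ∫⁻ z, (∑ σ : ι ↪ η, ∑ τ : ι' ↪ η', f (z.1 ∘ σ, z.2 ∘ τ)) * F z
        ∂((Measure.pi fun _ => μ).prod (Measure.pi fun _ => ν)) =
      Fintype.card (ι ↪ η) * Fintype.card (ι' ↪ η') *
        ∫⁻ w, f w * ∫⁻ v : (κ → α) × (κ' → β), F (glue e w.1 v.1, glue e' w.2 v.2)
            ∂((Measure.pi fun _ => μ).prod (Measure.pi fun _ => ν))
          ∂((Measure.pi fun _ => μ).prod (Measure.pi fun _ => ν)) := by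
  have hmeas (σ : ι ↪ η) (τ : ι' ↪ η') :
      Measurable fun z : (η → α) × (η' → β) => f (z.1 ∘ σ, z.2 ∘ τ) * F z :=
    (hf.comp (by fun_prop)).mul hF
  simp_rw [Finset.sum_mul]
  rw [lintegral_finsetSum _ fun σ _ => Finset.measurable_fun_sum _ fun τ _ => hmeas σ τ]
  simp_rw [lintegral_finsetSum _ fun τ _ => hmeas _ τ,
    lintegral_comp_embedding_mul hF hsymm hf e e']
  simp [mul_assoc]

end FactorialMoments

section CorrelationFunctions

open scoped ENNReal

theorem card_embedding_mul_factorial {ι η : Type*} [Fintype η] [Fintype (ι ↪ η)] {k : ℕ}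
    (e : ι ⊕ Fin k ≃ η) :
    Fintype.card (ι ↪ η) * k.factorial = (Fintype.card η).factorial := by
  classical
  have := Fintype.ofInjective _ (e.injective.comp Sum.inl_injective)
  have hcard : Fintype.card η = Fintype.card ι + k := by simpa using (Fintype.card_congr e).symm
  rw [Fintype.card_embedding_eq, hcard, mul_comm]
  simpa using Nat.factorial_mul_descFactorial (Nat.le_add_right (Fintype.card ι) k)

namespace BiorthogonalSystem

variable {α β : Type*} [MeasurableSpace α] [MeasurableSpace β] {μ : Measure α} {ν : Measure β}
  [SigmaFinite μ] [SigmaFinite ν] {N : ℕ} (S : BiorthogonalSystem μ ν N)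

theorem lintegral_correlationDet_glue_div {ι κ : Type*} [Fintype ι] [Fintype κ] [DecidableEq ι]
    [DecidableEq κ] (hS : ∀ (x : Fin N → α) (y : Fin N → β), 0 ≤ S.correlationDet x y) {k l : ℕ}
    (e : ι ⊕ Fin k ≃ Fin N) (f : κ ⊕ Fin l ≃ Fin N) (x : ι → α) (y : κ → β) :
    ∫⁻ z : (Fin k → α) × (Fin l → β),
        ENNReal.ofReal (S.correlationDet (glue e x z.1) (glue f y z.2) / N.factorial ^ 2)
        ∂((Measure.pi fun _ => μ).prod (Measure.pi fun _ => ν)) =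
      ENNReal.ofReal (k.factorial * l.factorial * S.correlationDet x y / N.factorial ^ 2) := by
  rw [← ofReal_integral_eq_lintegral_ofReal
    ((S.integrable_correlationDet_glue e f x y).div_const _)
    (.of_forall fun z => div_nonneg (hS _ _) (by positivity)), integral_div,
    S.integral_correlationDet_glue]

theorem lintegral_sum_comp_embedding_mul_correlationDet {ι κ : Type*} [Fintype ι] [Fintype κ]
    [DecidableEq ι] [DecidableEq κ]
    (hS : ∀ (x : Fin N → α) (y : Fin N → β), 0 ≤ S.correlationDet x y) {k l : ℕ}
    (e : ι ⊕ Fin k ≃ Fin N) (f : κ ⊕ Fin l ≃ Fin N)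
    {g : (ι → α) × (κ → β) → ℝ≥0∞} (hg : Measurable g) :
    ∫⁻ z, (∑ σ : ι ↪ Fin N, ∑ τ : κ ↪ Fin N, g (z.1 ∘ σ, z.2 ∘ τ)) *
        ENNReal.ofReal (S.correlationDet z.1 z.2 / N.factorial ^ 2)
        ∂((Measure.pi fun _ => μ).prod (Measure.pi fun _ => ν)) =
      ∫⁻ w, g w * ENNReal.ofReal (S.correlationDet w.1 w.2)
        ∂((Measure.pi fun _ => μ).prod (Measure.pi fun _ => ν)) := by
  have hcard : (Fintype.card (ι ↪ Fin N) * Fintype.card (κ ↪ Fin N) * (k.factorial * l.factorial) :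
      ℝ) = N.factorial ^ 2 := by
    rw [mul_mul_mul_comm, sq]
    have he := card_embedding_mul_factorial e
    have hf := card_embedding_mul_factorial f
    rw [Fintype.card_fin] at he hf
    exact_mod_cast congrArg₂ (· * ·) he hf
  rw [lintegral_sum_comp_embedding_mul (S.measurable_correlationDet.div_const _).ennreal_ofReal
    (fun π π' z => by rw [S.correlationDet_comp_equiv]) hg e f,
    ← lintegral_const_mul' _ _ (by finiteness)]
  refine lintegral_congr fun w => ?_
  rw [S.lintegral_correlationDet_glue_div hS, mul_left_comm, ← ENNReal.ofReal_natCast,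
    ← ENNReal.ofReal_natCast, ← ENNReal.ofReal_mul (by positivity),
    ← ENNReal.ofReal_mul (by positivity), ← mul_div_assoc, ← mul_assoc, hcard,
    mul_div_cancel_left₀ _ (by positivity)]

end BiorthogonalSystem

end CorrelationFunctions

/-! ### The explicit bi-orthogonal polynomials -/

section JacobiCoefficients

theorem prod_range_erase_sub {R : Type*} [CommRing R] {n l : ℕ} (hl : l ≤ n) :
    ∏ j ∈ (Finset.range (n + 1)).erase l, ((j : R) - l) =
      (-1) ^ l * (l.factorial * (n - l).factorial) := by
  have hsplit : (Finset.range (n + 1)).erase l = Finset.range l ∪ Finset.Ico (l + 1) (n + 1) := by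
    ext j; simp only [Finset.mem_erase, Finset.mem_range, Finset.mem_union, Finset.mem_Ico]; omega
  have hdisj : Disjoint (Finset.range l) (Finset.Ico (l + 1) (n + 1)) :=
    Finset.disjoint_left.2 fun j hj hj' => by simp at hj hj'; omega
  have hlower : ∏ j ∈ Finset.range l, ((j : R) - l) = (-1) ^ l * l.factorial := by
    simp_rw [← neg_sub (l : R)]
    rw [Finset.prod_neg, ← descPochhammer_eval_eq_prod_range, Finset.card_range,
      descPochhammer_eval_eq_descFactorial, Nat.descFactorial_self]
  have hupper : ∏ j ∈ Finset.Ico (l + 1) (n + 1), ((j : R) - l) = (n - l).factorial := by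
    rw [Finset.prod_Ico_eq_prod_range, ← Finset.prod_range_add_one_eq_factorial, Nat.cast_prod]
    exact Finset.prod_congr (by simp) fun j _ => by push_cast; ring
  rw [hsplit, Finset.prod_union hdisj, hlower, hupper, mul_assoc]

theorem Gamma_add_natCast {x : ℝ} (hx : 0 < x) (n : ℕ) :
    Real.Gamma (x + n) = (∏ j ∈ Finset.range n, (x + j)) * Real.Gamma x := by
  induction n with
  | zero => simp
  | succ n ih =>
    rw [Finset.prod_range_succ, Nat.cast_succ, ← add_assoc, Real.Gamma_add_one (by positivity), ih]
    ring

variable {α : ℝ} (hα : -1 < α)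
include hα

theorem jacobiCoeff_eq (n l : ℕ) :
    jacobiCoeff α n l = (-1) ^ l * (∏ j ∈ Finset.range n, (α + 1 + l + j)) /
      ((l.factorial : ℝ) * (n - l).factorial) := by
  have hpos : 0 < α + 1 + l := by linarith [Nat.cast_nonneg (α := ℝ) l]
  have hΓ := (Real.Gamma_pos_of_pos hpos).ne'
  rw [jacobiCoeff, show α + n + l + 1 = α + 1 + l + n by ring, add_right_comm α l 1,
    Gamma_add_natCast hpos]
  field_simp

theorem jacobiCoeff_ne_zero (n l : ℕ) : jacobiCoeff α n l ≠ 0 := by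
  rw [jacobiCoeff_eq hα]
  have hpos (j : ℕ) : 0 < α + 1 + l + j := by
    linarith [Nat.cast_nonneg (α := ℝ) l, Nat.cast_nonneg (α := ℝ) j]
  have := (Finset.prod_pos fun j (_ : j ∈ Finset.range n) => hpos j).ne'
  positivity

theorem nodalWeight_mul_eval_descPochhammer {n l : ℕ} (hl : l ≤ n) :
    Lagrange.nodalWeight (Finset.range (n + 1)) (fun l : ℕ => -(α + 1 + l)) l *
        (descPochhammer ℝ n).eval (-(α + 1 + l)) =
      (-1) ^ n * jacobiCoeff α n l := by
  have hweight : Lagrange.nodalWeight (Finset.range (n + 1)) (fun l : ℕ => -(α + 1 + l)) l =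
      ((-1) ^ l * (l.factorial * (n - l).factorial : ℝ))⁻¹ := by
    rw [Lagrange.nodalWeight, Finset.prod_inv_distrib, ← prod_range_erase_sub hl]
    exact congrArg _ (Finset.prod_congr rfl fun j _ => by ring)
  have heval : (descPochhammer ℝ n).eval (-(α + 1 + l)) =
      (-1) ^ n * ∏ j ∈ Finset.range n, (α + 1 + l + j) := by
    simp_rw [descPochhammer_eval_eq_prod_range, ← neg_add', Finset.prod_neg, Finset.card_range]
  rw [hweight, heval, jacobiCoeff_eq hα, mul_inv, ← inv_pow, inv_neg_one]
  ring

theorem sum_jacobiCoeff_div (n : ℕ) {s : ℝ} (hs : 0 ≤ s) :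
    ∑ l ∈ Finset.range (n + 1), jacobiCoeff α n l / (α + 1 + l + s) =
      (-1) ^ n * (descPochhammer ℝ n).eval s / ∏ l ∈ Finset.range (n + 1), (α + 1 + l + s) := by
  have hpos (l : ℕ) : 0 < α + 1 + l + s := by linarith [Nat.cast_nonneg (α := ℝ) l]
  have hnodes : Set.InjOn (fun l : ℕ => -(α + 1 + l)) (Finset.range (n + 1)) :=
    fun i _ j _ hij => by simpa using hij
  have hdeg : (descPochhammer ℝ n).degree < (Finset.range (n + 1)).card := by
    rw [Polynomial.degree_eq_natDegree (monic_descPochhammer ℝ n).ne_zero,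
      descPochhammer_natDegree, Finset.card_range]
    exact_mod_cast n.lt_succ_self
  have hnodal : (Lagrange.nodal (Finset.range (n + 1)) fun l : ℕ => -(α + 1 + l)).eval s =
      ∏ l ∈ Finset.range (n + 1), (α + 1 + l + s) := by
    rw [Lagrange.eval_nodal]
    exact Finset.prod_congr rfl fun l _ => by ring
  have hsign : ((-1 : ℝ) ^ n) * (-1) ^ n = 1 := by rw [← mul_pow]; simp
  rw [eq_div_iff (Finset.prod_pos fun l _ => hpos l).ne', eval_eq_eval_nodal_mul_sum hnodes hdeg
    fun l _ => by linarith [hpos l], hnodal, mul_left_comm, mul_comm]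
  congr 1
  rw [Finset.mul_sum]
  refine Finset.sum_congr rfl fun l hl => ?_
  rw [mul_right_comm, nodalWeight_mul_eval_descPochhammer hα (Finset.mem_range_succ_iff.1 hl),
    ← mul_assoc, ← mul_assoc, hsign, one_mul, sub_neg_eq_add, add_comm s, div_eq_mul_inv]

theorem jacobiCoeff_self_mul_factorial_div (n : ℕ) :
    jacobiCoeff α n n * ((-1) ^ n * n.factorial / ∏ l ∈ Finset.range (n + 1), (α + 1 + l + n)) =
      1 / (2 * n + α + 1) := by
  have hn := Nat.cast_nonneg (α := ℝ) n
  have hprod : ∏ j ∈ Finset.range n, (α + 1 + n + j) ≠ 0 :=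
    Finset.prod_ne_zero_iff.2 fun j _ => by linarith [hn, Nat.cast_nonneg (α := ℝ) j]
  have hlast : 2 * n + α + 1 ≠ 0 := by linarith [hn]
  have hsign : ((-1 : ℝ) ^ n) * (-1) ^ n = 1 := by rw [← mul_pow]; simp
  simp_rw [jacobiCoeff_eq hα, Finset.prod_range_succ, add_right_comm (α + 1) _ (n : ℝ),
    Nat.sub_self, Nat.factorial_zero, Nat.cast_one, mul_one]
  rw [show α + 1 + (n : ℝ) + n = 2 * n + α + 1 by ring]
  field_simp [hlast]
  linear_combination 1 / (2 * n + α + 1) * hsign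

theorem sum_jacobiCoeff_mul_of_le {n m : ℕ} (hmn : m ≤ n) :
    ∑ k ∈ Finset.range (m + 1), ∑ l ∈ Finset.range (n + 1),
      jacobiCoeff α n l * jacobiCoeff α m k / (α + 1 + l + k) =
      if n = m then 1 / (2 * n + α + 1) else 0 := by
  have hinner (k : ℕ) : ∑ l ∈ Finset.range (n + 1),
      jacobiCoeff α n l * jacobiCoeff α m k / (α + 1 + l + k) = jacobiCoeff α m k *
        ((-1) ^ n * (descPochhammer ℝ n).eval (k : ℝ) /
          ∏ l ∈ Finset.range (n + 1), (α + 1 + l + k)) := by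
    rw [← sum_jacobiCoeff_div hα n (Nat.cast_nonneg k), Finset.mul_sum]
    exact Finset.sum_congr rfl fun l _ => by ring
  have hvanish {k : ℕ} (hk : k < n) : jacobiCoeff α m k *
      ((-1) ^ n * (descPochhammer ℝ n).eval (k : ℝ) /
        ∏ l ∈ Finset.range (n + 1), (α + 1 + l + k)) = 0 := by
    rw [descPochhammer_eval_coe_nat_of_lt hk]; simp
  simp_rw [hinner]
  rw [Finset.sum_range_succ, Finset.sum_eq_zero fun k hk =>
    hvanish ((Finset.mem_range.1 hk).trans_le hmn), zero_add]
  split_ifs with h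
  · subst h
    rw [descPochhammer_eval_eq_descFactorial, Nat.descFactorial_self,
      jacobiCoeff_self_mul_factorial_div hα]
  · exact hvanish (lt_of_le_of_ne hmn (Ne.symm h))

theorem sum_jacobiCoeff_mul (n m : ℕ) :
    ∑ l ∈ Finset.range (n + 1), ∑ k ∈ Finset.range (m + 1),
      jacobiCoeff α n l * jacobiCoeff α m k / (α + 1 + l + k) =
      if n = m then 1 / (2 * n + α + 1) else 0 := by
  rcases le_total m n with h | h
  · rw [Finset.sum_comm, sum_jacobiCoeff_mul_of_le hα h]
  · rw [Finset.sum_congr rfl fun l _ => Finset.sum_congr rfl fun k _ => by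
      rw [mul_comm, add_right_comm], sum_jacobiCoeff_mul_of_le hα h]
    rcases eq_or_ne n m with rfl | hnm
    · simp
    · simp [hnm, hnm.symm]

end JacobiCoefficients

section CauchyLaguerreIntegral

open Real Set

theorem lintegral_exp_neg_mul_Ioi_one {u : ℝ} (hu : 0 < u) :
    ∫⁻ t in Ioi (1 : ℝ), ENNReal.ofReal (exp (-(t * u))) = ENNReal.ofReal (exp (-u) / u) := by
  have hintegral := integral_exp_mul_Ioi (neg_lt_zero.2 hu) 1
  have hintegrable := integrableOn_exp_mul_Ioi (neg_lt_zero.2 hu) 1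
  simp only [neg_mul, mul_one] at hintegral hintegrable
  simp_rw [mul_comm _ u]
  rw [← ofReal_integral_eq_lintegral_ofReal hintegrable (.of_forall fun t => (exp_pos _).le),
    hintegral, neg_div_neg_eq]

theorem integrableOn_rpow_mul_exp_neg_mul {A t : ℝ} (hA : -1 < A) (ht : 0 < t) :
    IntegrableOn (fun x => x ^ A * exp (-(t * x))) (Ioi 0) := by
  simpa using integrableOn_rpow_mul_exp_neg_mul_rpow hA one_pos ht

theorem lintegral_rpow_mul_exp_neg_mul_Ioi {A t : ℝ} (hA : -1 < A) (ht : 0 < t) :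
    ∫⁻ x in Ioi (0 : ℝ), ENNReal.ofReal (x ^ A * exp (-(t * x))) =
      ENNReal.ofReal (Gamma (A + 1) * t ^ (-(A + 1))) := by
  have h := integral_rpow_mul_exp_neg_mul_Ioi (a := A + 1) (by linarith) ht
  rw [add_sub_cancel_right] at h
  rw [← ofReal_integral_eq_lintegral_ofReal (integrableOn_rpow_mul_exp_neg_mul hA ht), h, mul_comm,
    one_div, inv_rpow ht.le, rpow_neg ht.le]
  filter_upwards [ae_restrict_mem measurableSet_Ioi] with x (hx : 0 < x)
  positivity

theorem lintegral_rpow_Ioi_one {A : ℝ} (hA : 1 < A) :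
    ∫⁻ t in Ioi (1 : ℝ), ENNReal.ofReal (t ^ (-A)) = ENNReal.ofReal (1 / (A - 1)) := by
  rw [← ofReal_integral_eq_lintegral_ofReal (integrableOn_Ioi_rpow_of_lt (by linarith) one_pos),
    integral_Ioi_rpow_of_lt (by linarith) one_pos, one_rpow, show -A + 1 = -(A - 1) by ring,
    neg_div_neg_eq]
  filter_upwards [ae_restrict_mem measurableSet_Ioi] with t ht
  have : 0 < t := one_pos.trans ht
  positivity

theorem ofReal_cauchy_laguerre_eq_lintegral (A B : ℝ) {x y : ℝ} (hx : 0 < x) (hy : 0 < y) :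
    ENNReal.ofReal (exp (-(x + y)) / (x + y) * x ^ A * y ^ B) =
      ∫⁻ t in Ioi (1 : ℝ), ENNReal.ofReal (x ^ A * exp (-(t * x))) *
        ENNReal.ofReal (y ^ B * exp (-(t * y))) := by
  rw [show exp (-(x + y)) / (x + y) * x ^ A * y ^ B =
      (x ^ A * y ^ B) * (exp (-(x + y)) / (x + y)) by ring, ENNReal.ofReal_mul (by positivity),
    ← lintegral_exp_neg_mul_Ioi_one (add_pos hx hy), ← lintegral_const_mul _ (by fun_prop)]
  refine lintegral_congr fun t => ?_
  rw [← ENNReal.ofReal_mul (by positivity), ← ENNReal.ofReal_mul (by positivity), mul_add, neg_add,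
    exp_add]
  congr 1
  ring

theorem lintegral_rpow_mul_exp_mul_rpow_mul_exp {A B t : ℝ} (hA : -1 < A) (hB : -1 < B)
    (ht : 0 < t) :
    ∫⁻ z in Ioi (0 : ℝ) ×ˢ Ioi (0 : ℝ), ENNReal.ofReal (z.1 ^ A * exp (-(t * z.1))) *
        ENNReal.ofReal (z.2 ^ B * exp (-(t * z.2))) =
      ENNReal.ofReal (Gamma (A + 1) * Gamma (B + 1)) * ENNReal.ofReal (t ^ (-(A + B + 2))) := by
  have hΓA := Gamma_pos_of_pos (neg_lt_iff_pos_add.1 hA)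
  have hΓB := Gamma_pos_of_pos (neg_lt_iff_pos_add.1 hB)
  rw [Measure.volume_eq_prod, ← Measure.prod_restrict,
    lintegral_prod_mul (f := fun x => ENNReal.ofReal (x ^ A * exp (-(t * x))))
      (g := fun y => ENNReal.ofReal (y ^ B * exp (-(t * y)))) (by fun_prop) (by fun_prop),
    lintegral_rpow_mul_exp_neg_mul_Ioi hA ht, lintegral_rpow_mul_exp_neg_mul_Ioi hB ht,
    ← ENNReal.ofReal_mul (by positivity), ← ENNReal.ofReal_mul (by positivity),
    show -(A + B + 2) = -(A + 1) + -(B + 1) by ring, rpow_add ht]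
  congr 1
  ring

theorem lintegral_cauchy_laguerre {A B : ℝ} (hA : -1 < A) (hB : -1 < B) (hAB : -1 < A + B) :
    ∫⁻ z in Ioi (0 : ℝ) ×ˢ Ioi (0 : ℝ),
        ENNReal.ofReal (exp (-(z.1 + z.2)) / (z.1 + z.2) * z.1 ^ A * z.2 ^ B) =
      ENNReal.ofReal (Gamma (A + 1) * Gamma (B + 1) / (A + B + 1)) := by
  have hΓA := Gamma_pos_of_pos (neg_lt_iff_pos_add.1 hA)
  have hΓB := Gamma_pos_of_pos (neg_lt_iff_pos_add.1 hB)
  have hmeas : Measurable (Function.uncurry fun (z : ℝ × ℝ) (t : ℝ) =>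
      ENNReal.ofReal (z.1 ^ A * exp (-(t * z.1))) *
        ENNReal.ofReal (z.2 ^ B * exp (-(t * z.2)))) := by
    simp only [Function.uncurry_def]
    fun_prop
  rw [setLIntegral_congr_fun (measurableSet_Ioi.prod measurableSet_Ioi) fun z hz =>
      ofReal_cauchy_laguerre_eq_lintegral A B hz.1 hz.2,
    lintegral_lintegral_swap hmeas.aemeasurable,
    setLIntegral_congr_fun measurableSet_Ioi fun t ht =>
      lintegral_rpow_mul_exp_mul_rpow_mul_exp hA hB (one_pos.trans ht),
    lintegral_const_mul _ (by fun_prop), lintegral_rpow_Ioi_one (by linarith),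
    ← ENNReal.ofReal_mul (by positivity), mul_one_div, show A + B + 2 - 1 = A + B + 1 by ring]

theorem cauchy_laguerre_nonneg_ae (A B : ℝ) :
    0 ≤ᵐ[volume.restrict (Ioi (0 : ℝ) ×ˢ Ioi (0 : ℝ))]
      fun z => exp (-(z.1 + z.2)) / (z.1 + z.2) * z.1 ^ A * z.2 ^ B := by
  filter_upwards [ae_restrict_mem (measurableSet_Ioi.prod measurableSet_Ioi)] with z ⟨hx, hy⟩
  simp only [mem_Ioi] at hx hy
  simp only [Pi.zero_apply]
  positivity

theorem integrableOn_cauchy_laguerre {A B : ℝ} (hA : -1 < A) (hB : -1 < B) (hAB : -1 < A + B) :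
    IntegrableOn (fun z : ℝ × ℝ => exp (-(z.1 + z.2)) / (z.1 + z.2) * z.1 ^ A * z.2 ^ B)
      (Ioi (0 : ℝ) ×ˢ Ioi (0 : ℝ)) := by
  refine (lintegral_ofReal_ne_top_iff_integrable (Measurable.aestronglyMeasurable (by fun_prop))
    (cauchy_laguerre_nonneg_ae A B)).1 ?_
  rw [lintegral_cauchy_laguerre hA hB hAB]
  exact ENNReal.ofReal_ne_top

theorem integral_cauchy_laguerre {A B : ℝ} (hA : -1 < A) (hB : -1 < B) (hAB : -1 < A + B) :
    ∫ z in Ioi (0 : ℝ) ×ˢ Ioi (0 : ℝ), exp (-(z.1 + z.2)) / (z.1 + z.2) * z.1 ^ A * z.2 ^ B =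
      Gamma (A + 1) * Gamma (B + 1) / (A + B + 1) := by
  have hΓA := Gamma_pos_of_pos (neg_lt_iff_pos_add.1 hA)
  have hΓB := Gamma_pos_of_pos (neg_lt_iff_pos_add.1 hB)
  have hAB' := neg_lt_iff_pos_add.1 hAB
  rw [integral_eq_lintegral_of_nonneg_ae (cauchy_laguerre_nonneg_ae A B)
    (Measurable.aestronglyMeasurable (by fun_prop)), lintegral_cauchy_laguerre hA hB hAB,
    ENNReal.toReal_ofReal (by positivity)]

end CauchyLaguerreIntegral

section Biorthogonality

open Polynomial

theorem natDegree_sum_range_monomial {R : Type*} [Semiring R] {n : ℕ} {c : ℕ → R} (hc : c n ≠ 0) :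
    (∑ l ∈ Finset.range (n + 1), monomial l (c l)).natDegree = n := by
  refine natDegree_eq_of_le_of_coeff_ne_zero ?_ ?_
  · exact natDegree_sum_le_of_forall_le _ _ fun l hl =>
      (natDegree_monomial_le _).trans (Finset.mem_range_succ_iff.1 hl)
  · simpa [finsetSum_coeff, coeff_monomial] using hc

theorem rpow_mul_eval_sum_monomial {x : ℝ} (hx : 0 < x) (c θ : ℝ) (s : Finset ℕ) (u : ℕ → ℝ) :
    x ^ c * (∑ l ∈ s, monomial l (u l)).eval (x ^ θ) = ∑ l ∈ s, u l * x ^ (c + θ * l) := by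
  rw [eval_finsetSum, Finset.mul_sum]
  refine Finset.sum_congr rfl fun l _ => ?_
  rw [eval_monomial, Real.rpow_add hx, Real.rpow_mul hx.le, Real.rpow_natCast]
  ring

variable {a b θ : ℝ} (ha : -1 < a) (hb : -1 < b) (hab : -1 < a + b)
include ha hb hab

theorem integral_cauchy_laguerre_mul_eval_mul_eval (hθ : 0 ≤ θ) (s t : Finset ℕ) (u v : ℕ → ℝ) :
    ∫ z in Set.Ioi (0 : ℝ) ×ˢ Set.Ioi (0 : ℝ),
        Real.exp (-(z.1 + z.2)) / (z.1 + z.2) * z.1 ^ a * z.2 ^ b *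
          (∑ l ∈ s, monomial l (u l)).eval (z.1 ^ θ) *
          (∑ k ∈ t, monomial k (v k)).eval (z.2 ^ θ) =
      ∑ l ∈ s, ∑ k ∈ t, u l * v k * (Real.Gamma (a + θ * l + 1) * Real.Gamma (b + θ * k + 1) /
        (a + θ * l + (b + θ * k) + 1)) := by
  have hθn (l : ℕ) : 0 ≤ θ * l := by positivity
  have hA (l : ℕ) : -1 < a + θ * l := by linarith [hθn l]
  have hB (k : ℕ) : -1 < b + θ * k := by linarith [hθn k]
  have hAB (l k : ℕ) : -1 < a + θ * l + (b + θ * k) := by linarith [hθn l, hθn k]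
  have hint (l k : ℕ) :=
    (integrableOn_cauchy_laguerre (hA l) (hB k) (hAB l k)).const_mul (u l * v k)
  have hexpand : ∀ z ∈ Set.Ioi (0 : ℝ) ×ˢ Set.Ioi (0 : ℝ),
      Real.exp (-(z.1 + z.2)) / (z.1 + z.2) * z.1 ^ a * z.2 ^ b *
          (∑ l ∈ s, monomial l (u l)).eval (z.1 ^ θ) *
          (∑ k ∈ t, monomial k (v k)).eval (z.2 ^ θ) =
        ∑ l ∈ s, ∑ k ∈ t, u l * v k *
          (Real.exp (-(z.1 + z.2)) / (z.1 + z.2) * z.1 ^ (a + θ * l) * z.2 ^ (b + θ * k)) := by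
    rintro z ⟨hx, hy⟩
    calc _ = Real.exp (-(z.1 + z.2)) / (z.1 + z.2) *
          ((z.1 ^ a * (∑ l ∈ s, monomial l (u l)).eval (z.1 ^ θ)) *
            (z.2 ^ b * (∑ k ∈ t, monomial k (v k)).eval (z.2 ^ θ))) := by ring
      _ = _ := by
        rw [rpow_mul_eval_sum_monomial hx, rpow_mul_eval_sum_monomial hy, Finset.sum_mul_sum,
          Finset.mul_sum]
        simp_rw [Finset.mul_sum]
        exact Finset.sum_congr rfl fun l _ => Finset.sum_congr rfl fun k _ => by ring
  rw [setIntegral_congr_fun (measurableSet_Ioi.prod measurableSet_Ioi) hexpand,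
    integral_finsetSum _ fun l _ => integrable_finsetSum _ fun k _ => hint l k]
  simp_rw [integral_finsetSum _ fun k _ => hint _ k, integral_const_mul,
    integral_cauchy_laguerre (hA _) (hB _) (hAB _ _)]

theorem isCauchyBiorthogonal_PHat_QHat (hθ : 0 < θ) :
    IsCauchyBiorthogonal a b θ (PHat a b θ) (QHat a b θ) := by
  have hα : -1 < alphaParam a b θ := by
    linarith [show 0 < alphaParam a b θ + 1 by
      rw [alphaParam, sub_add_cancel]; exact div_pos (by linarith) hθ]
  have hαθ : θ * (alphaParam a b θ + 1) = a + b + 1 := by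
    rw [alphaParam, sub_add_cancel, mul_div_cancel₀ _ hθ.ne']
  have hΓ {c : ℝ} (hc : -1 < c) (l : ℕ) : Real.Gamma (c + θ * l + 1) ≠ 0 :=
    (Real.Gamma_pos_of_pos (by linarith [show 0 ≤ θ * l by positivity])).ne'
  have hlead {c : ℝ} (hc : -1 < c) (n : ℕ) :
      jacobiCoeff (alphaParam a b θ) n n / Real.Gamma (c + θ * n + 1) ≠ 0 :=
    div_ne_zero (jacobiCoeff_ne_zero hα n n) (hΓ hc n)
  refine ⟨fun n => ⟨natDegree_sum_range_monomial (hlead ha n),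
    natDegree_sum_range_monomial (hlead hb n)⟩, fun n m => ?_⟩
  have hterm (l k : ℕ) : jacobiCoeff (alphaParam a b θ) n l / Real.Gamma (a + θ * l + 1) *
      (jacobiCoeff (alphaParam a b θ) m k / Real.Gamma (b + θ * k + 1)) *
      (Real.Gamma (a + θ * l + 1) * Real.Gamma (b + θ * k + 1) / (a + θ * l + (b + θ * k) + 1)) =
      jacobiCoeff (alphaParam a b θ) n l * jacobiCoeff (alphaParam a b θ) m k /
        (alphaParam a b θ + 1 + l + k) / θ := by
    rw [show a + θ * l + (b + θ * k) + 1 = θ * (alphaParam a b θ + 1 + l + k) by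
      linear_combination -hαθ]
    field_simp [hΓ ha l, hΓ hb k]
  rw [PHat, QHat, integral_cauchy_laguerre_mul_eval_mul_eval ha hb hab hθ.le]
  simp_rw [hterm, ← Finset.sum_div]
  rw [sum_jacobiCoeff_mul hα, hNorm, show 2 * n * θ + a + b + 1 =
    θ * (2 * n + alphaParam a b θ + 1) by linear_combination -hαθ]
  split_ifs
  · field_simp
  · simp

end Biorthogonality

/-! ### Kernels of the Cauchy–Laguerre model -/

section LaguerreSystem

open Set

theorem one_div_add_le_rpow_mul_rpow {x y s : ℝ} (hx : 0 < x) (hy : 0 < y) (hs : s ∈ Icc 0 1) :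
    1 / (x + y) ≤ x ^ (-s) * y ^ (s - 1) := by
  have hle : x ^ s * y ^ (1 - s) ≤ x + y := by
    calc x ^ s * y ^ (1 - s) ≤ (x + y) ^ s * (x + y) ^ (1 - s) := by
          gcongr <;> linarith [hs.1, hs.2]
      _ = x + y := by rw [← Real.rpow_add (by positivity), add_sub_cancel, Real.rpow_one]
  calc 1 / (x + y) ≤ 1 / (x ^ s * y ^ (1 - s)) := one_div_le_one_div_of_le (by positivity) hle
    _ = x ^ (-s) * y ^ (s - 1) := by
      rw [Real.rpow_neg hx.le, ← neg_sub s, Real.rpow_neg hy.le, one_div, mul_inv, inv_inv]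

/-- The Cauchy kernel `1 / (x + y)` on the positive half-line, extended by zero so that it has a
majorant of product form on the whole plane. -/
def cauchyKernel (x y : ℝ) : ℝ := if 0 < x ∧ 0 < y then 1 / (x + y) else 0

theorem cauchyKernel_of_pos {x y : ℝ} (hx : 0 < x) (hy : 0 < y) :
    cauchyKernel x y = 1 / (x + y) := if_pos ⟨hx, hy⟩

theorem measurable_cauchyKernel : Measurable (Function.uncurry cauchyKernel) :=
  Measurable.ite ((measurableSet_lt measurable_const measurable_fst).inter
    (measurableSet_lt measurable_const measurable_snd)) (by fun_prop) (by fun_prop)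

theorem abs_cauchyKernel_le {s : ℝ} (hs : s ∈ Icc 0 1) (x y : ℝ) :
    |cauchyKernel x y| ≤ |x ^ (-s)| * |y ^ (s - 1)| := by
  unfold cauchyKernel
  split_ifs with h
  · rw [abs_of_pos (one_div_pos.2 (add_pos h.1 h.2)), abs_of_pos (Real.rpow_pos_of_pos h.1 _),
      abs_of_pos (Real.rpow_pos_of_pos h.2 _)]
    exact one_div_add_le_rpow_mul_rpow h.1 h.2 hs
  · rw [abs_zero]
    positivity

theorem measurable_weight (c : ℝ) : Measurable (weight c) := by
  unfold weight; fun_prop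

theorem weight_pos (c : ℝ) {x : ℝ} (hx : 0 < x) : 0 < weight c x := by
  unfold weight; positivity

theorem integrableOn_eval_rpow_mul_weight {c θ : ℝ} (hc : -1 < c) (hθ : 0 ≤ θ) (R : Polynomial ℝ) :
    IntegrableOn (fun x => R.eval (x ^ θ) * weight c x) (Ioi 0) := by
  have hexpand : EqOn (fun x : ℝ => ∑ l ∈ Finset.range (R.natDegree + 1),
      R.coeff l * (x ^ (c + θ * l) * Real.exp (-(1 * x))))
      (fun x => R.eval (x ^ θ) * weight c x) (Ioi 0) := by
    intro x (hx : 0 < x)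
    simp only [Polynomial.eval_eq_sum_range, Finset.sum_mul, weight]
    refine Finset.sum_congr rfl fun l _ => ?_
    rw [Real.rpow_add hx, Real.rpow_mul hx.le, Real.rpow_natCast, one_mul]
    ring
  refine IntegrableOn.congr_fun (integrable_finsetSum _ fun l _ => ?_) hexpand measurableSet_Ioi
  have : 0 ≤ θ * l := by positivity
  exact (integrableOn_rpow_mul_exp_neg_mul (by linarith) one_pos).const_mul _

theorem integrableOn_eval_rpow_mul_weight_mul_rpow {c t θ : ℝ} (hct : -1 < c + t) (hθ : 0 ≤ θ)
    (R : Polynomial ℝ) :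
    IntegrableOn (fun x => R.eval (x ^ θ) * weight c x * |x ^ t|) (Ioi 0) := by
  refine (integrableOn_eval_rpow_mul_weight hct hθ R).congr_fun (fun x (hx : 0 < x) => ?_)
    measurableSet_Ioi
  simp only [weight]
  rw [abs_of_pos (by positivity), Real.rpow_add hx]
  ring

theorem hNorm_pos {a b θ : ℝ} (hab : -1 < a + b) (hθ : 0 < θ) (n : ℕ) : 0 < hNorm a b θ n :=
  div_pos hθ (by linarith [show 0 ≤ 2 * n * θ by positivity])

/-- A `θ`-deformed Cauchy bi-orthogonal pair, together with the standing assumptions on the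
parameters of the model. -/
structure IsLaguerrePair (a b θ : ℝ) (P Q : ℕ → Polynomial ℝ) : Prop where
  neg_one_lt_left : -1 < a
  neg_one_lt_right : -1 < b
  neg_one_lt_add : -1 < a + b
  pos : 0 < θ
  isCauchyBiorthogonal : IsCauchyBiorthogonal a b θ P Q

/-- An exponent `s ∈ [0, 1]` for which both `x ^ (a - s)` and `y ^ (b + s - 1)` are integrable at
the origin, so that `x ^ (-s) * y ^ (s - 1)` can serve as a majorant of the Cauchy kernel. -/
def majorantExponent (a b : ℝ) : ℝ := (max 0 (-b) + min 1 (a + 1)) / 2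

theorem majorantExponent_mem {a b : ℝ} (ha : -1 < a) (hb : -1 < b) (hab : -1 < a + b) :
    majorantExponent a b ∈ Icc 0 1 ∩ Ioo (-b) (a + 1) := by
  have hlt : max 0 (-b) < min 1 (a + 1) := by
    simp only [lt_min_iff, max_lt_iff]; refine ⟨⟨?_, ?_⟩, ?_, ?_⟩ <;> linarith
  have := le_max_left 0 (-b)
  have := le_max_right 0 (-b)
  have := min_le_left 1 (a + 1)
  have := min_le_right 1 (a + 1)
  refine ⟨⟨?_, ?_⟩, ?_, ?_⟩ <;> unfold majorantExponent <;> linarith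

namespace IsLaguerrePair

variable {a b θ : ℝ} {P Q : ℕ → Polynomial ℝ} (h : IsLaguerrePair a b θ P Q)
include h

theorem integral_mul_cauchyKernel_mul (n m : ℕ) :
    ∫ z, θ / hNorm a b θ n * ((P n).eval (z.1 ^ θ) * weight a z.1) * cauchyKernel z.1 z.2 *
        ((Q m).eval (z.2 ^ θ) * weight b z.2)
        ∂((volume.restrict (Ioi (0 : ℝ))).prod (volume.restrict (Ioi (0 : ℝ)))) =
      if n = m then 1 else 0 := by
  have hcongr : EqOn (fun z : ℝ × ℝ => θ / hNorm a b θ n * ((P n).eval (z.1 ^ θ) * weight a z.1) *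
        cauchyKernel z.1 z.2 * ((Q m).eval (z.2 ^ θ) * weight b z.2))
      (fun z => θ / hNorm a b θ n * (Real.exp (-(z.1 + z.2)) / (z.1 + z.2) *
        z.1 ^ a * z.2 ^ b * (P n).eval (z.1 ^ θ) * (Q m).eval (z.2 ^ θ)))
      (Ioi 0 ×ˢ Ioi 0) := by
    rintro z ⟨hx, hy⟩
    simp only [weight, cauchyKernel_of_pos hx hy]
    rw [neg_add, Real.exp_add]
    ring
  have hθ := h.pos
  have hn := hNorm_pos h.neg_one_lt_add h.pos n
  rw [Measure.prod_restrict, ← Measure.volume_eq_prod,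
    setIntegral_congr_fun (measurableSet_Ioi.prod measurableSet_Ioi) hcongr, integral_const_mul,
    h.isCauchyBiorthogonal.2 n m]
  split_ifs
  · field_simp
  · simp

/-- The bi-orthogonal system on the half-line attached to `P` and `Q`, with the weights and the
normalisation of the Christoffel–Darboux kernel absorbed into the functions. -/
def system (N : ℕ) :
    BiorthogonalSystem (volume.restrict (Ioi (0 : ℝ))) (volume.restrict (Ioi (0 : ℝ))) N where
  C := cauchyKernel
  p n x := θ / hNorm a b θ n * ((P n).eval (x ^ θ) * weight a x)
  q n y := (Q n).eval (y ^ θ) * weight b y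
  φ x := |x ^ (-majorantExponent a b)|
  ψ y := |y ^ (majorantExponent a b - 1)|
  measurable_C := measurable_cauchyKernel
  measurable_p n := (((P n).continuous.measurable.comp (by fun_prop)).mul
    (measurable_weight a)).const_mul _
  measurable_q n := ((Q n).continuous.measurable.comp (by fun_prop)).mul (measurable_weight b)
  abs_C_le := abs_cauchyKernel_le
    (majorantExponent_mem h.neg_one_lt_left h.neg_one_lt_right h.neg_one_lt_add).1
  integrable_p_mul_φ n := by
    have hs := (majorantExponent_mem h.neg_one_lt_left h.neg_one_lt_right h.neg_one_lt_add).2.2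
    simp_rw [mul_assoc (θ / hNorm a b θ n)]
    exact (integrableOn_eval_rpow_mul_weight_mul_rpow (by linarith) h.pos.le (P n)).const_mul _
  integrable_q_mul_ψ n := by
    have hs := (majorantExponent_mem h.neg_one_lt_left h.neg_one_lt_right h.neg_one_lt_add).2.1
    exact integrableOn_eval_rpow_mul_weight_mul_rpow (by linarith) h.pos.le (Q n)
  biorthogonal n m := by simpa only [Fin.val_inj] using h.integral_mul_cauchyKernel_mul n m

variable (N : ℕ)

theorem system_C_of_pos {x y : ℝ} (hx : 0 < x) (hy : 0 < y) :
    (h.system N).C x y = 1 / (x + y) := cauchyKernel_of_pos hx hy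

end IsLaguerrePair

end LaguerreSystem

namespace IsLaguerrePair

open Set

variable {a b θ : ℝ} {P Q : ℕ → Polynomial ℝ} (h : IsLaguerrePair a b θ P Q) (N : ℕ)
include h

theorem K01Integrand_eqOn (x : ℝ) {x' : ℝ} (hx' : 0 < x') :
    EqOn (fun y => ∑ n : Fin N, θ / hNorm a b θ n * (P n).eval (x ^ θ) *
      ((h.system N).q n y * (h.system N).C x' y)) (K01Integrand a b θ P Q N x x') (Ioi 0) := by
  intro y hy
  simp only [K01Integrand, K00, Finset.sum_range, Finset.sum_div, Finset.sum_mul,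
    system, cauchyKernel_of_pos hx' hy]
  exact Finset.sum_congr rfl fun n _ => by ring

theorem K10Integrand_eqOn {y : ℝ} (hy : 0 < y) (y' : ℝ) :
    EqOn (fun x => ∑ n : Fin N, (Q n).eval (y' ^ θ) *
      ((h.system N).p n x * (h.system N).C x y)) (K10Integrand a b θ P Q N y y') (Ioi 0) := by
  intro x hx
  simp only [K10Integrand, K00, Finset.sum_range, Finset.sum_div, Finset.sum_mul,
    system, cauchyKernel_of_pos hx hy]
  exact Finset.sum_congr rfl fun n _ => by ring

theorem K11Integrand_eqOn {y x : ℝ} (hy : 0 < y) (hx : 0 < x) :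
    EqOn (fun z => ∑ n : Fin N, ((h.system N).p n z.1 * (h.system N).C z.1 y) *
      ((h.system N).q n z.2 * (h.system N).C x z.2)) (K11Integrand a b θ P Q N y x)
      (Ioi 0 ×ˢ Ioi 0) := by
  rintro z ⟨hx', hy'⟩
  simp only [K11Integrand, K00, Finset.sum_range, Finset.sum_div, Finset.sum_mul,
    system, cauchyKernel_of_pos hx' hy, cauchyKernel_of_pos hx hy']
  exact Finset.sum_congr rfl fun n _ => by rw [div_eq_mul_inv _ (_ * _), mul_inv]; ring

theorem kernelsConverge : KernelsConverge a b θ P Q N := by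
  intro u v hu hv
  refine ⟨?_, ?_, ?_⟩
  · exact IntegrableOn.congr_fun (integrable_finsetSum _ fun n _ =>
      ((h.system N).integrable_q_mul_C n v).const_mul _) (h.K01Integrand_eqOn N u hv)
      measurableSet_Ioi
  · exact IntegrableOn.congr_fun (integrable_finsetSum _ fun n _ =>
      ((h.system N).integrable_p_mul_C n u).const_mul _) (h.K10Integrand_eqOn N hu v)
      measurableSet_Ioi
  · refine IntegrableOn.congr_fun ?_ (h.K11Integrand_eqOn N hu hv)
      (measurableSet_Ioi.prod measurableSet_Ioi)
    rw [IntegrableOn, Measure.volume_eq_prod, ← Measure.prod_restrict]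
    exact integrable_finsetSum _ fun n _ =>
      ((h.system N).integrable_p_mul_C n u).mul_prod ((h.system N).integrable_q_mul_C n v)

theorem weight_mul_K00_mul_weight (x y : ℝ) :
    weight a x * K00 a b θ P Q N x y * weight b y =
      ∑ n, (h.system N).p n x * (h.system N).q n y := by
  rw [K00, Finset.sum_range, Finset.mul_sum, Finset.sum_mul]
  exact Finset.sum_congr rfl fun n _ => by simp only [system]; ring

theorem weight_mul_K01 (x : ℝ) {x' : ℝ} (hx' : 0 < x') :
    weight a x * K01 a b θ P Q N x x' =
      ∑ n, (h.system N).p n x * (h.system N).rightTransform n x' := by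
  rw [K01, ← setIntegral_congr_fun measurableSet_Ioi (h.K01Integrand_eqOn N x hx'),
    integral_finsetSum _ fun n _ => ((h.system N).integrable_q_mul_C n x').const_mul _,
    Finset.mul_sum]
  refine Finset.sum_congr rfl fun n _ => ?_
  rw [integral_const_mul, BiorthogonalSystem.rightTransform]
  simp only [system]
  ring

theorem K10_mul_weight {y : ℝ} (hy : 0 < y) (y' : ℝ) :
    K10 a b θ P Q N y y' * weight b y' =
      ∑ n, (h.system N).leftTransform n y * (h.system N).q n y' := by
  rw [K10, ← setIntegral_congr_fun measurableSet_Ioi (h.K10Integrand_eqOn N hy y'),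
    integral_finsetSum _ fun n _ => ((h.system N).integrable_p_mul_C n y).const_mul _,
    Finset.sum_mul]
  refine Finset.sum_congr rfl fun n _ => ?_
  rw [integral_const_mul, BiorthogonalSystem.leftTransform]
  simp only [system]
  ring

theorem K11_eq {y x : ℝ} (hy : 0 < y) (hx : 0 < x) :
    K11 a b θ P Q N y x =
      ∑ n, (h.system N).leftTransform n y * (h.system N).rightTransform n x -
        (h.system N).C x y := by
  rw [K11, ← setIntegral_congr_fun (measurableSet_Ioi.prod measurableSet_Ioi)
      (h.K11Integrand_eqOn N hy hx), h.system_C_of_pos N hx hy, Measure.volume_eq_prod,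
    ← Measure.prod_restrict, integral_finsetSum _ fun n _ =>
      ((h.system N).integrable_p_mul_C n y).mul_prod ((h.system N).integrable_q_mul_C n x)]
  exact congrArg (· - _) (Finset.sum_congr rfl fun n _ => integral_prod_mul
    (fun u => (h.system N).p n u * (h.system N).C u y)
    (fun v => (h.system N).q n v * (h.system N).C x v))

theorem correlationDet_eq_det_kernelMatrix {r s : ℕ} {x : Fin r → ℝ} {y : Fin s → ℝ}
    (hx : x ∈ posOrthant r) (hy : y ∈ posOrthant s) :
    (h.system N).correlationDet x y = (∏ i, weight a (x i)) * (∏ j, weight b (y j)) *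
      (kernelMatrix a b θ P Q N x y).det := by
  have hfactor : (h.system N).correlationMatrix x y =
      Matrix.diagonal (Sum.elim (fun i => weight a (x i)) 1) * kernelMatrix a b θ P Q N x y *
      Matrix.diagonal (Sum.elim 1 fun j => weight b (y j)) := by
    ext (i | i) (j | j) <;>
      simp [BiorthogonalSystem.correlationMatrix, kernelMatrix, h.weight_mul_K01 N _ (hx _),
        h.K10_mul_weight N (hy _), h.weight_mul_K00_mul_weight, h.K11_eq N (hy _) (hx _)]
  rw [BiorthogonalSystem.correlationDet, hfactor, Matrix.det_mul, Matrix.det_mul,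
    Matrix.det_diagonal, Matrix.det_diagonal, Fintype.prod_sum_type, Fintype.prod_sum_type]
  simp only [Sum.elim_inl, Sum.elim_inr, Pi.one_apply, Finset.prod_const_one]
  ring

end IsLaguerrePair

/-! ### The point process -/

section Model

open Set

theorem posOrthant_eq_pi (n : ℕ) : posOrthant n = univ.pi fun _ => Ioi (0 : ℝ) := by
  ext x; simp [posOrthant]

theorem measurableSet_posOrthant_prod (m n : ℕ) :
    MeasurableSet (posOrthant m ×ˢ posOrthant n) := by
  have hmeas (k : ℕ) : MeasurableSet (posOrthant k) := by
    rw [posOrthant_eq_pi]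
    exact .univ_pi fun _ => measurableSet_Ioi
  exact (hmeas m).prod (hmeas n)

theorem volume_restrict_posOrthant_prod (m n : ℕ) :
    (volume : Measure ((Fin m → ℝ) × (Fin n → ℝ))).restrict (posOrthant m ×ˢ posOrthant n) =
      (Measure.pi fun _ => volume.restrict (Ioi 0)).prod
        (Measure.pi fun _ => volume.restrict (Ioi 0)) := by
  rw [Measure.volume_eq_prod, ← Measure.prod_restrict, posOrthant_eq_pi, posOrthant_eq_pi,
    volume_pi, volume_pi, Measure.restrict_pi_pi, Measure.restrict_pi_pi]

theorem prodDiff_mul_prodDiff_rpow_nonneg {N : ℕ} {θ : ℝ} (hθ : 0 ≤ θ) {x : Fin N → ℝ}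
    (hx : x ∈ posOrthant N) : 0 ≤ prodDiff x * prodDiff fun j => x j ^ θ := by
  simp_rw [prodDiff, ← Finset.prod_mul_distrib]
  refine Finset.prod_nonneg fun j _ => Finset.prod_nonneg fun k _ => ?_
  rcases le_total (x j) (x k) with hjk | hkj
  · exact mul_nonneg (sub_nonneg.2 hjk) (sub_nonneg.2 (Real.rpow_le_rpow (hx j).le hjk hθ))
  · exact mul_nonneg_of_nonpos_of_nonpos (sub_nonpos.2 hkj)
      (sub_nonpos.2 (Real.rpow_le_rpow (hx k).le hkj hθ))

theorem density_nonneg {N : ℕ} (a b : ℝ) {θ : ℝ} (hθ : 0 ≤ θ) {x y : Fin N → ℝ}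
    (hx : x ∈ posOrthant N) (hy : y ∈ posOrthant N) : 0 ≤ density a b θ x y := by
  have hweight : 0 ≤ ∏ j, weight a (x j) * weight b (y j) :=
    Finset.prod_nonneg fun j _ => (mul_pos (weight_pos a (hx j)) (weight_pos b (hy j))).le
  have hcauchy : 0 ≤ ∏ j, ∏ k, (x j + y k) :=
    Finset.prod_nonneg fun j _ => Finset.prod_nonneg fun k _ => (add_pos (hx j) (hy k)).le
  have hdiff := mul_nonneg (prodDiff_mul_prodDiff_rpow_nonneg hθ hx)
    (prodDiff_mul_prodDiff_rpow_nonneg hθ hy)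
  exact (div_nonneg (mul_nonneg hweight hdiff) hcauchy).trans_eq (by unfold density; ring)

theorem density_eq_det {N : ℕ} (a b θ : ℝ) {x y : Fin N → ℝ}
    (hx : x ∈ posOrthant N) (hy : y ∈ posOrthant N) :
    density a b θ x y = (∏ j, weight a (x j)) * (∏ j, weight b (y j)) *
      (prodDiff (fun j => x j ^ θ) * prodDiff (fun j => y j ^ θ) *
        (Matrix.of fun i j => 1 / (x i + y j)).det) := by
  rw [det_cauchy x y fun i j => (add_pos (hx i) (hy j)).ne', ← prodDiff_eq_det_vandermonde,
    ← prodDiff_eq_det_vandermonde, density, Finset.prod_mul_distrib]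
  ring

/-- The splitting of `N` variables into the first `r` and the remaining `N - r`. -/
def joinEquiv {r N : ℕ} (hr : r ≤ N) : Fin r ⊕ Fin (N - r) ≃ Fin N :=
  finSumFinEquiv.trans (finCongr (Nat.add_sub_cancel' hr))

theorem glue_joinEquiv {r N : ℕ} (hr : r ≤ N) (x : Fin r → ℝ) (x' : Fin (N - r) → ℝ) :
    glue (joinEquiv hr) x x' = joinVars hr x x' := by
  rw [glue, Equiv.comp_symm_eq]
  ext (i | i) <;> simp [joinVars, joinEquiv]

theorem joinVars_mem_posOrthant {r N : ℕ} (hr : r ≤ N) {x : Fin r → ℝ} {x' : Fin (N - r) → ℝ}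
    (hx : x ∈ posOrthant r) (hx' : x' ∈ posOrthant (N - r)) : joinVars hr x x' ∈ posOrthant N := by
  intro i
  rw [← glue_joinEquiv, glue, Function.comp_apply]
  rcases (joinEquiv hr).symm i with j | j
  · exact hx j
  · exact hx' j

theorem density_joinVars (a b θ : ℝ) {r s N : ℕ} (hr : r ≤ N) (hs : s ≤ N) {x : Fin r → ℝ}
    {y : Fin s → ℝ} (hx : x ∈ posOrthant r) (hy : y ∈ posOrthant s)
    {z : (Fin (N - r) → ℝ) × (Fin (N - s) → ℝ)}
    (hz : z ∈ posOrthant (N - r) ×ˢ posOrthant (N - s)) :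
    density a b θ (joinVars hr x z.1) (joinVars hs y z.2) =
      (∏ i, weight a (x i)) * (∏ j, weight b (y j)) * correlationIntegrand a b θ hr hs x y z := by
  rw [density_eq_det a b θ (joinVars_mem_posOrthant hr hx hz.1)
    (joinVars_mem_posOrthant hs hy hz.2), correlationIntegrand]
  simp_rw [← glue_joinEquiv, prod_comp_glue]
  ring

end Model

/-- The product of the leading coefficients of the polynomials `θ / h_n * P_n` and `Q_n`, `n < N`,
which is the ratio between the full determinant of kernels and the density of the model. -/
def leadingConst (a b θ : ℝ) (P Q : ℕ → Polynomial ℝ) (N : ℕ) : ℝ :=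
  (∏ n : Fin N, θ / hNorm a b θ n * (P n).coeff n) * ∏ n : Fin N, (Q n).coeff n

theorem det_eval_rpow_mul_weight {N : ℕ} (c θ : ℝ) (z : Fin N → ℝ) (p : Fin N → Polynomial ℝ)
    (hp : ∀ n, (p n).natDegree ≤ n) :
    (Matrix.of fun i n => (p n).eval (z i ^ θ) * weight c (z i)).det =
      (∏ i, weight c (z i)) * ((∏ n, (p n).coeff n) * prodDiff fun i => z i ^ θ) := by
  rw [prodDiff_eq_det_vandermonde, ← det_eval_eq_prod_coeff_mul_det_vandermonde _ p hp,
    ← Matrix.det_mul_column]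
  simp only [Matrix.of_apply, mul_comm]

namespace IsLaguerrePair

variable {a b θ : ℝ} {P Q : ℕ → Polynomial ℝ} (h : IsLaguerrePair a b θ P Q) (N : ℕ)
include h

theorem correlationDet_eq_leadingConst_mul_density {x y : Fin N → ℝ} (hx : x ∈ posOrthant N)
    (hy : y ∈ posOrthant N) :
    (h.system N).correlationDet x y = leadingConst a b θ P Q N * density a b θ x y := by
  have hp := det_eval_rpow_mul_weight a θ x
    (fun n => Polynomial.C (θ / hNorm a b θ n) * P n)
    fun n => (Polynomial.natDegree_C_mul_le _ _).trans (h.isCauchyBiorthogonal.1 n).1.le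
  have hq := det_eval_rpow_mul_weight b θ y (fun n => Q n)
    fun n => (h.isCauchyBiorthogonal.1 n).2.le
  have hC : (Matrix.of fun i j => (h.system N).C (x i) (y j)) =
      Matrix.of fun i j => 1 / (x i + y j) := by
    ext i j; exact h.system_C_of_pos N (hx i) (hy j)
  simp only [Polynomial.eval_mul, Polynomial.eval_C, Polynomial.coeff_C_mul, mul_assoc] at hp
  rw [BiorthogonalSystem.correlationDet_eq_det_mul_det_mul_det, hC, density_eq_det a b θ hx hy,
    leadingConst]
  simp only [system]
  rw [hp, hq]
  ring

theorem correlationDet_eq_zero {x y : Fin N → ℝ} (hxy : ¬(x ∈ posOrthant N ∧ y ∈ posOrthant N)) :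
    (h.system N).correlationDet x y = 0 := by
  rw [BiorthogonalSystem.correlationDet_eq_det_mul_det_mul_det]
  refine mul_eq_zero_of_right _ ?_
  rcases not_and_or.1 hxy with hx | hy
  · obtain ⟨i, hi⟩ := not_forall.1 hx
    exact Matrix.det_eq_zero_of_row_eq_zero i fun j => if_neg fun hpos => hi hpos.1
  · obtain ⟨j, hj⟩ := not_forall.1 hy
    exact Matrix.det_eq_zero_of_column_eq_zero j fun i => if_neg fun hpos => hj hpos.2

theorem leadingConst_mul_integral_density :
    leadingConst a b θ P Q N * ∫ z in posOrthant N ×ˢ posOrthant N, density a b θ z.1 z.2 =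
      (N.factorial : ℝ) ^ 2 := by
  rw [← (h.system N).integral_correlationDet, ← volume_restrict_posOrthant_prod,
    ← integral_const_mul]
  exact setIntegral_congr_fun (measurableSet_posOrthant_prod N N) fun z hz =>
    (h.correlationDet_eq_leadingConst_mul_density N hz.1 hz.2).symm

theorem leadingConst_mul_partitionFunction :
    leadingConst a b θ P Q N * partitionFunction N a b θ = 1 := by
  rw [partitionFunction, mul_left_comm, h.leadingConst_mul_integral_density, ← mul_pow,
    one_div_mul_cancel (by positivity), one_pow]

theorem leadingConst_pos : 0 < leadingConst a b θ P Q N := by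
  refine pos_of_mul_pos_left
    (b := ∫ z in posOrthant N ×ˢ posOrthant N, density a b θ z.1 z.2) ?_ ?_
  · rw [h.leadingConst_mul_integral_density]
    positivity
  · exact setIntegral_nonneg (measurableSet_posOrthant_prod N N) fun z hz =>
      density_nonneg a b h.pos.le hz.1 hz.2

theorem correlationDet_nonneg (x y : Fin N → ℝ) : 0 ≤ (h.system N).correlationDet x y := by
  by_cases hxy : x ∈ posOrthant N ∧ y ∈ posOrthant N
  · rw [h.correlationDet_eq_leadingConst_mul_density N hxy.1 hxy.2]
    exact mul_nonneg (h.leadingConst_pos N).le (density_nonneg a b h.pos.le hxy.1 hxy.2)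
  · exact (h.correlationDet_eq_zero N hxy).ge

theorem law_eq_withDensity :
    law N a b θ = ((Measure.pi fun _ => volume.restrict (Set.Ioi 0)).prod
      (Measure.pi fun _ => volume.restrict (Set.Ioi 0))).withDensity
        fun z => ENNReal.ofReal ((h.system N).correlationDet z.1 z.2 / N.factorial ^ 2) := by
  have hκ := (h.leadingConst_pos N).ne'
  rw [law, ← volume_restrict_posOrthant_prod]
  refine withDensity_congr_ae ?_
  filter_upwards [ae_restrict_mem (measurableSet_posOrthant_prod N N)] with z hz
  rw [h.correlationDet_eq_leadingConst_mul_density N hz.1 hz.2,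
    ← mul_div_mul_left (density a b θ z.1 z.2) _ hκ, mul_left_comm _ (_ ^ 2),
    h.leadingConst_mul_partitionFunction, mul_one]

theorem isProbabilityMeasure_law : IsProbabilityMeasure (law N a b θ) := by
  refine ⟨?_⟩
  rw [h.law_eq_withDensity, withDensity_apply _ .univ, Measure.restrict_univ,
    ← ofReal_integral_eq_lintegral_ofReal ((h.system N).integrable_correlationDet.div_const _)
      (.of_forall fun z => div_nonneg (h.correlationDet_nonneg N _ _) (by positivity)),
    integral_div, (h.system N).integral_correlationDet, div_self (by positivity),
    ENNReal.ofReal_one]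

section Correlation

variable {N} {r s : ℕ} (hr : r ≤ N) (hs : s ≤ N) {x : Fin r → ℝ} {y : Fin s → ℝ}

theorem correlationDet_joinVars (hx : x ∈ posOrthant r) (hy : y ∈ posOrthant s)
    {z : (Fin (N - r) → ℝ) × (Fin (N - s) → ℝ)}
    (hz : z ∈ posOrthant (N - r) ×ˢ posOrthant (N - s)) :
    (h.system N).correlationDet (joinVars hr x z.1) (joinVars hs y z.2) =
      leadingConst a b θ P Q N * ((∏ i, weight a (x i)) * ∏ j, weight b (y j)) *
        correlationIntegrand a b θ hr hs x y z := by
  rw [h.correlationDet_eq_leadingConst_mul_density N (joinVars_mem_posOrthant hr hx hz.1)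
    (joinVars_mem_posOrthant hs hy hz.2), density_joinVars a b θ hr hs hx hy hz, ← mul_assoc]

theorem integrableOn_correlationIntegrand (hx : x ∈ posOrthant r) (hy : y ∈ posOrthant s) :
    IntegrableOn (correlationIntegrand a b θ hr hs x y)
      (posOrthant (N - r) ×ˢ posOrthant (N - s)) := by
  have hint := (h.system N).integrable_correlationDet_glue (joinEquiv hr) (joinEquiv hs) x y
  simp only [glue_joinEquiv] at hint
  rw [← volume_restrict_posOrthant_prod] at hint
  have hconst : leadingConst a b θ P Q N * ((∏ i, weight a (x i)) * ∏ j, weight b (y j)) ≠ 0 :=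
    (mul_pos (h.leadingConst_pos N) (mul_pos (Finset.prod_pos fun i _ => weight_pos a (hx i))
      (Finset.prod_pos fun j _ => weight_pos b (hy j)))).ne'
  exact (integrable_const_mul_iff (isUnit_iff_ne_zero.2 hconst) _).1 <|
    IntegrableOn.congr_fun hint (fun z hz => h.correlationDet_joinVars hr hs hx hy hz)
      (measurableSet_posOrthant_prod _ _)

theorem correlation_eq_correlationDet (hx : x ∈ posOrthant r) (hy : y ∈ posOrthant s) :
    correlation a b θ hr hs x y = (h.system N).correlationDet x y := by
  have hintegral := (h.system N).integral_correlationDet_glue (joinEquiv hr) (joinEquiv hs) x y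
  simp only [glue_joinEquiv] at hintegral
  rw [← volume_restrict_posOrthant_prod, setIntegral_congr_fun (measurableSet_posOrthant_prod _ _)
    fun z hz => h.correlationDet_joinVars hr hs hx hy hz, integral_const_mul] at hintegral
  have hκZ := h.leadingConst_mul_partitionFunction N
  have hZ : partitionFunction N a b θ ≠ 0 := right_ne_zero_of_mul_eq_one hκZ
  have hdenom : ((N - r).factorial : ℝ) * (N - s).factorial * partitionFunction N a b θ ≠ 0 := by
    positivity
  rw [correlation, div_mul_eq_mul_div, div_eq_iff hdenom]
  apply mul_left_cancel₀ (h.leadingConst_pos N).ne'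
  linear_combination hintegral -
    ((N - r).factorial * (N - s).factorial * (h.system N).correlationDet x y) * hκZ

theorem isCorrelationFunction_correlation :
    IsCorrelationFunction (law N a b θ) r s (correlation a b θ hr hs) := by
  intro f hf
  have hdensity : Measurable fun z : (Fin N → ℝ) × (Fin N → ℝ) =>
      ENNReal.ofReal ((h.system N).correlationDet z.1 z.2 / N.factorial ^ 2) :=
    ((h.system N).measurable_correlationDet.div_const _).ennreal_ofReal
  have hsum : Measurable fun z : (Fin N → ℝ) × (Fin N → ℝ) =>
      ∑ σ : Fin r ↪ Fin N, ∑ τ : Fin s ↪ Fin N, f (z.1 ∘ σ, z.2 ∘ τ) :=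
    Finset.measurable_fun_sum _ fun σ _ => Finset.measurable_fun_sum _ fun τ _ =>
      hf.comp (by fun_prop)
  rw [h.law_eq_withDensity, lintegral_withDensity_eq_lintegral_mul _ hdensity hsum]
  simp only [Pi.mul_apply, mul_comm (ENNReal.ofReal _)]
  rw [(h.system N).lintegral_sum_comp_embedding_mul_correlationDet (h.correlationDet_nonneg N)
    (joinEquiv hr) (joinEquiv hs) hf, ← volume_restrict_posOrthant_prod]
  refine setLIntegral_congr_fun (measurableSet_posOrthant_prod r s) fun w hw => ?_
  simp only [h.correlation_eq_correlationDet hr hs hw.1 hw.2]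

end Correlation

end IsLaguerrePair

end CauchyLaguerre

end

theorem mainTheorem5 (a b θ : ℝ) (ha : -1 < a) (hb : -1 < b) (hab : -1 < a + b) (hθ : 0 < θ)
    (N : ℕ) :
    (∀ x ∈ CauchyLaguerre.posOrthant N, ∀ y ∈ CauchyLaguerre.posOrthant N,
      0 ≤ CauchyLaguerre.density a b θ x y) ∧
    MeasureTheory.IsProbabilityMeasure (CauchyLaguerre.law N a b θ) ∧
    CauchyLaguerre.IsCauchyBiorthogonal a b θ
      (CauchyLaguerre.PHat a b θ) (CauchyLaguerre.QHat a b θ) ∧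
    ∀ P Q : ℕ → Polynomial ℝ, CauchyLaguerre.IsCauchyBiorthogonal a b θ P Q →
      CauchyLaguerre.KernelsConverge a b θ P Q N ∧
      ∀ (r s : ℕ) (hr : r ≤ N) (hs : s ≤ N),
        CauchyLaguerre.IsCorrelationFunction (CauchyLaguerre.law N a b θ) r s
          (CauchyLaguerre.correlation a b θ hr hs) ∧
        ∀ x ∈ CauchyLaguerre.posOrthant r, ∀ y ∈ CauchyLaguerre.posOrthant s,
          MeasureTheory.IntegrableOn (CauchyLaguerre.correlationIntegrand a b θ hr hs x y)
            (CauchyLaguerre.posOrthant (N - r) ×ˢ CauchyLaguerre.posOrthant (N - s)) ∧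
          CauchyLaguerre.correlation a b θ hr hs x y =
            (∏ i, x i ^ a * Real.exp (-x i)) * (∏ j, y j ^ b * Real.exp (-y j)) *
              (CauchyLaguerre.kernelMatrix a b θ P Q N x y).det := by
  have hHat := CauchyLaguerre.isCauchyBiorthogonal_PHat_QHat ha hb hab hθ
  have hLaguerre P Q (h : CauchyLaguerre.IsCauchyBiorthogonal a b θ P Q) :
      CauchyLaguerre.IsLaguerrePair a b θ P Q := ⟨ha, hb, hab, hθ, h⟩
  refine ⟨fun x hx y hy => CauchyLaguerre.density_nonneg a b hθ.le hx hy,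
    (hLaguerre _ _ hHat).isProbabilityMeasure_law N, hHat, fun P Q h => ?_⟩
  replace h := hLaguerre P Q h
  refine ⟨h.kernelsConverge N, fun r s hr hs =>
    ⟨h.isCorrelationFunction_correlation hr hs, fun x hx y hy =>
      ⟨h.integrableOn_correlationIntegrand hr hs hx hy, ?_⟩⟩⟩
  rw [h.correlation_eq_correlationDet hr hs hx hy]
  exact h.correlationDet_eq_det_kernelMatrix N hx hy
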